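/- Let $\delta,F>0$, $G(h,q)=\frac{q^2}{h}+\frac{h^2}{2F^2}$, $S(h,q)=h-\frac{q^2}{h^2}$, and consider the Saint-Venant equations $$\partial_t h+\partial_x q=0,\qquad \partial_t q+\partial_x G(h,q)=S(h,q)+\delta\,\partial_x^2 q .$$ Let $(c,\bar q)\mapsto (L(c,\bar q),H(\cdot\,;c,\bar q))$ be a smooth family, defined on an open subset of $\mathbb R^2$, of roll-waves: $L(c,\bar q)\neq0$, $H(\cdot\,;c,\bar q)$ is a positive, non-constant, $L(c,\bar q)$-periodic solution of $$\delta c H''-\Big(\frac{\bar q^2}{H}+\frac{H^2}{2F^2}\Big)'+H-\Big(c-\frac{\bar q}{H}\Big)^2=0 ,$$ so that $(h,q)(x,t)=(H,Q)(x-ct)$ with $Q=cH-\bar q$ is a travelling wave of speed $c$. Set $k=1/L$, $\omega=-kc$, $M=\frac1L\int_0^L H$, $N=cM-\bar q$; the first-order Whitham system is $\partial_t k-\partial_x\omega=0$, $\partial_t M+\partial_x N=0$. Fix $(c_\star,\bar q_\star)$ in the domain of the family with $c_\star\neq0$, indicate by $\star$ values at $(c_\star,\bar q_\star)$, and suppose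 that the Floquet multiplier $$\rho=\exp\Big(\frac1{\delta c_\star}\int_0^{L_\star}\big(\partial_hG(H_\star,Q_\star)+c_\star\,\partial_qG(H_\star,Q_\star)-c_\star^2\big)\Big)$$ of the linearized profile equation is different from $1$. Let $Y'=A(\lambda)Y$, $Y=(q,h,h')$, be the first-order form of the spectral problem $$(q-c_\star h)'+\lambda h=0,\qquad (dG(H_\star,Q_\star)(h,q)-c_\star q)'+\lambda q=dS(H_\star,Q_\star)(h,q)+\delta q'' ,$$ let $\Psi(\cdot\,;\lambda)$ be its resolvent matrix with $\Psi(0;\lambda)=\mathrm{Id}$, and let $E(\lambda,\sigma)=\det(\Psi(L_\star;\lambda)-\sigma\,\mathrm{Id})$ be the Evans function. Let $$D(\lambda,\nu)=\det\begin{pmatrix}\lambda\,\partial_cL_\star-\nu & \lambda\,\partial_{\bar q}L_\star\\ \lambda\,\partial_cM_\star+\frac{\nu}{L_\star} M_\star & \lambda\,\partial_{\bar q}M_\star-\frac{\nu}{L_\star}\end{pmatrix}.$$ Then: (i) There is $\Gamma\neq0$ such that, as $(\lambda,\nu)\to(0,0)$ in $\mathbb C^2$, $$E(\lambda,e^{\nu})=\Gamma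 D(\lambda,\nu)+O\big((|\lambda|+|\nu|)^3\big).$$ (ii) $D(\lambda,\nu)=0$ is the dispersion relation of the linearized Whitham system: for $(\lambda,\nu)\in\mathbb C^2$, $D(\lambda,\nu)=0$ if and only if there is a nonzero constant vector $(c_1,\bar q_1)\in\mathbb C^2$ such that $e^{\lambda t+k_\star\nu x}(c_1,\bar q_1)$ solves the Whitham system written in the frame $(x-c_\star t,t)$ and linearized about $(c_\star,\bar q_\star)$. (iii) If the family is normalized by $H(0;c,\bar q)=M(c,\bar q)$, then, with $\langle f\rangle=\frac1{L_\star}\int_0^{L_\star}f$, $$D(\lambda,\nu)=\lambda^2\big(\partial_cL_\star\langle\partial_{\bar q}H_\star\rangle-\partial_{\bar q}L_\star\langle\partial_cH_\star\rangle\big)-\lambda\nu\Big(\frac{\partial_cL_\star}{L_\star}+\langle\partial_{\bar q}H_\star\rangle+\frac{M_\star\,\partial_{\bar q}L_\star}{L_\star}\Big)+\frac{\nu^2}{L_\star}.$$ -/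

import Mathlib

open scoped ContDiff Topology

/-- Momentum flux `G(h,q) = q²/h + h²/(2F²)` of the Saint-Venant equations. -/
noncomputable def fluxG (F h q : ℝ) : ℝ := q ^ 2 / h + h ^ 2 / (2 * F ^ 2)

/-- Source term `S(h,q) = h - q²/h²` (gravity and turbulent friction). -/
noncomputable def sourceS (h q : ℝ) : ℝ := h - q ^ 2 / h ^ 2

noncomputable def fluxG_h (F h q : ℝ) : ℝ := deriv (fun z => fluxG F z q) h
noncomputable def fluxG_q (F h q : ℝ) : ℝ := deriv (fun z => fluxG F h z) q
noncomputable def sourceS_h (h q : ℝ) : ℝ := deriv (fun z => sourceS z q) h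
noncomputable def sourceS_q (h q : ℝ) : ℝ := deriv (fun z => sourceS h z) q

/-- `h` solves, in the physical variable, the equation of profiles of travelling waves of speed `c`
and relative discharge `qb`, the discharge being `q = c h - qb`. -/
def SolvesProfile (δ F c qb : ℝ) (h : ℝ → ℝ) : Prop :=
  ∀ x, δ * c * deriv (deriv h) x
    - deriv (fun y => qb ^ 2 / h y + h y ^ 2 / (2 * F ^ 2)) x
    + h x - (c - qb / h x) ^ 2 = 0

/-- `H x c qb` is a smooth family, parametrized by the wave speed `c` and the relative discharge
`qb`, of (continuous, non-constant) roll-waves, with period `L c qb`. -/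
structure IsRollWaveFamily (δ F : ℝ) (U : Set (ℝ × ℝ)) (L : ℝ → ℝ → ℝ) (H : ℝ → ℝ → ℝ → ℝ) :
    Prop where
  isOpen : IsOpen U
  smooth_L : ContDiffOn ℝ ∞ (fun p : ℝ × ℝ => L p.1 p.2) U
  smooth_H : ContDiffOn ℝ ∞ (fun p : ℝ × ℝ × ℝ => H p.1 p.2.1 p.2.2) (Set.univ ×ˢ U)
  L_ne_zero : ∀ c qb, (c, qb) ∈ U → L c qb ≠ 0
  H_pos : ∀ x c qb, (c, qb) ∈ U → 0 < H x c qb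
  periodic : ∀ c qb, (c, qb) ∈ U → Function.Periodic (fun x => H x c qb) (L c qb)
  nonconst : ∀ c qb, (c, qb) ∈ U → ∃ x, H x c qb ≠ H 0 c qb
  profile : ∀ c qb, (c, qb) ∈ U → SolvesProfile δ F c qb (fun x => H x c qb)

/-! ### The linearized Saint-Venant equations and the Evans function -/

/-- The matrix `A(λ)` of the spectral problem
`(q - c h)' + λ h = 0`, `(dG(H,Q)(h,q) - c q)' + λ q = dS(H,Q)(h,q) + δ q''`, `Q = c H - qb`,
written as a first order system `Y' = A(λ) Y` for `Y = (q, h, h')`. -/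
noncomputable def evansMatrix (δ F c qb : ℝ) (H : ℝ → ℝ) (lam : ℂ) (x : ℝ) :
    Matrix (Fin 3) (Fin 3) ℂ :=
  let Gh : ℝ → ℝ := fun y => fluxG_h F (H y) (c * H y - qb)
  let Gq : ℝ → ℝ := fun y => fluxG_q F (H y) (c * H y - qb)
  let Sh : ℝ := sourceS_h (H x) (c * H x - qb)
  let Sq : ℝ := sourceS_q (H x) (c * H x - qb)
  !![0, -lam, (c : ℂ);
     0, 0, 1;
     (((deriv Gq x - Sq : ℝ) : ℂ) + lam) / ((δ * c : ℝ) : ℂ),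
     (((deriv Gh x - Sh : ℝ) : ℂ) + ((c - Gq x : ℝ) : ℂ) * lam) / ((δ * c : ℝ) : ℂ),
     (((Gh x + c * Gq x - c ^ 2 : ℝ) : ℂ) + (δ : ℂ) * lam) / ((δ * c : ℝ) : ℂ)]

/-- `Ψ` is the resolvent matrix of `Y' = A Y` with `Ψ(0) = Id`. -/
def IsResolvent (A Ψ : ℝ → Matrix (Fin 3) (Fin 3) ℂ) : Prop :=
  Ψ 0 = 1 ∧ ∀ x i j, HasDerivAt (fun y => Ψ y i j) ((A x * Ψ x) i j) x

open Classical in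
/-- The resolvent matrix of `Y' = A Y`; it exists and is unique for continuous `A`. -/
noncomputable def resolventMatrix (A : ℝ → Matrix (Fin 3) (Fin 3) ℂ) :
    ℝ → Matrix (Fin 3) (Fin 3) ℂ :=
  if h : ∃ Ψ, IsResolvent A Ψ then h.choose else 0

/-- The Evans function `E(λ,σ) = det (Ψ(L;λ) - σ Id)` of the `L`-periodic wave `H`. -/
noncomputable def evansFunction (δ F c qb L : ℝ) (H : ℝ → ℝ) (lam σ : ℂ) : ℂ :=
  (resolventMatrix (evansMatrix δ F c qb H lam) L - σ • (1 : Matrix (Fin 3) (Fin 3) ℂ)).det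

/-- The nontrivial Floquet multiplier
`ρ = exp ((1/(δ c)) ∫₀ᴸ (dG(H,Q)(1,c) - c²))` of the profile equation linearized about `H`. -/
noncomputable def floquetMultiplier (δ F c qb L : ℝ) (H : ℝ → ℝ) : ℝ :=
  Real.exp ((1 / (δ * c)) * ∫ x in (0 : ℝ)..L,
    (fluxG_h F (H x) (c * H x - qb) + c * fluxG_q F (H x) (c * H x - qb) - c ^ 2))

/-! ### The first-order Whitham system `∂ₜ k - ∂ₓ ω = 0`, `∂ₜ M + ∂ₓ N = 0` -/

/-- Mean value `⟨f⟩_L`. -/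
noncomputable def meanL (L : ℝ) (f : ℝ → ℝ) : ℝ := (1 / L) * ∫ x in (0 : ℝ)..L, f x

noncomputable def waveNumber (L : ℝ → ℝ → ℝ) (c qb : ℝ) : ℝ := 1 / L c qb

noncomputable def timeFrequency (L : ℝ → ℝ → ℝ) (c qb : ℝ) : ℝ := -(waveNumber L c qb * c)

noncomputable def massM (L : ℝ → ℝ → ℝ) (H : ℝ → ℝ → ℝ → ℝ) (c qb : ℝ) : ℝ :=
  meanL (L c qb) (fun x => H x c qb)

noncomputable def massFluxN (L : ℝ → ℝ → ℝ) (H : ℝ → ℝ → ℝ → ℝ) (c qb : ℝ) : ℝ :=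
  c * massM L H c qb - qb

/-- Partial derivatives with respect to the parameters. -/
noncomputable def dc (f : ℝ → ℝ → ℝ) (c qb : ℝ) : ℝ := deriv (fun z => f z qb) c
noncomputable def dq (f : ℝ → ℝ → ℝ) (c qb : ℝ) : ℝ := deriv (fun z => f c z) qb

/-- The differential of `f` at `(c, qb)`, applied to a complex vector. -/
noncomputable def dpar (f : ℝ → ℝ → ℝ) (c qb : ℝ) (v : ℂ × ℂ) : ℂ :=
  (dc f c qb : ℂ) * v.1 + (dq f c qb : ℂ) * v.2

/-- `w(x,t)`, perturbation of the parameters `(c, qb)`, solves the first-order Whitham system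
written in the frame `(x - c t, t)` and linearized about the constant state `(c, qb)`. -/
def SolvesLinearizedWhitham (L : ℝ → ℝ → ℝ) (H : ℝ → ℝ → ℝ → ℝ) (c qb : ℝ)
    (w : ℝ → ℝ → ℂ × ℂ) : Prop :=
  ContDiff ℝ 1 (fun p : ℝ × ℝ => w p.1 p.2) ∧
  ∀ x t : ℝ,
    deriv (fun s => dpar (waveNumber L) c qb (w x s)) t
      + deriv (fun y => -dpar (timeFrequency L) c qb (w y t)
          - (c : ℂ) * dpar (waveNumber L) c qb (w y t)) x = 0 ∧
    deriv (fun s => dpar (massM L H) c qb (w x s)) t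
      + deriv (fun y => dpar (massFluxN L H) c qb (w y t)
          - (c : ℂ) * dpar (massM L H) c qb (w y t)) x = 0

/-- The function `D(λ,ν)` giving the dispersion relation `D(λ,ν) = 0` of the linearized Whitham
system `dL ∂ₜ(c,qb) - L ∂ₓ c = 0`, `dM ∂ₜ(c,qb) + M ∂ₓ c - ∂ₓ qb = 0`, for plane waves
`exp(λ t + ν x / L) (c₁, q₁)`. -/
noncomputable def whithamDispersion (L : ℝ → ℝ → ℝ) (H : ℝ → ℝ → ℝ → ℝ) (c qb : ℝ)
    (lam ν : ℂ) : ℂ :=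
  Matrix.det
    !![lam * (dc L c qb : ℂ) - ν, lam * (dq L c qb : ℂ);
       lam * (dc (massM L H) c qb : ℂ) + ν / (L c qb : ℂ) * (massM L H c qb : ℂ),
       lam * (dq (massM L H) c qb : ℂ) - ν / (L c qb : ℂ)]

/-! Let `V₀`, `Vc`, `Vq` be the derivatives of the family in `x`, `c`, `q̄`, in the variables
`(q,h,h')`, and write `A(λ) = A₀ + λ A₁`. Differentiating the profile equation shows that `V₀` and
`Vq` solve `Y' = A₀ Y`, while `Vc` solves it with forcing `-A₁ V₀`. Hence `V₀ - λ Vc` solves `Y' =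
A(λ) Y` up to `O(λ²)` (`hasDerivAt_variation`). The period depends on the parameters, so the
derivatives in `c` and `q̄` are not periodic: they change over a period by `-∂L • V₀(0)`
(`variation_parameter_at_period`).

At `λ = 0` the plane `q = c h` is invariant. It contains `V₀`, of multiplier `1`; Liouville's
formula makes `ρ` the other multiplier, and `ρ ≠ 1` provides an eigensolution `V₃`
(`exists_floquet_solution`). The values at `0` of `V₀`, `Vq`, `V₃` form a basis of `ℂ³`, in which
the coordinate along `Vq` is `-(q - c h)`. Since `(q - c h)' = -λ h`, this coordinate of a solution
at `L` is known to one order more than the solution itself.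

Applying `Ψ(L;λ) - e^ν` to `V₀ - λ Vc`, `Vq`, `V₃` at `0` gives, to third order, the determinant `(ρ
- 1) ((λ ∂_c L - ν)(λ I_q - ν) - ∂_q̄ L (λ ν H(0) + λ² I_c))`, where `I_c`, `I_q` are the integrals
of `∂_c H`, `∂_q̄ H` over `[0, L]` (`evans_expansion`). Replacing `V₀` by `V₀ - λ Vc` costs a factor
`1 - κ λ`, which is harmless at this order. Finally `L ∂M = ∂L (H(0) - M) + ∫ ∂H`
(`hasDerivAt_massM_line`), which turns the expression into `(ρ - 1) L D(λ,ν)`; thus `Γ = (ρ - 1) L`.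

For (ii), a plane wave reduces the linearized Whitham system to a homogeneous 2×2 system of
determinant `D`. For (iii), the normalization cancels `H(0) - M`, so that `∂M = ⟨∂H⟩`. -/

/-! ### Linear differential equations: global existence and Gronwall's estimate. -/

section LinearODE

variable {E : Type*} [NormedAddCommGroup E] [NormedSpace ℝ E]

/-- Picard iterates of the linear equation `y' = A y`, `y 0 = y₀`, as a series of corrections. -/
noncomputable def picardTerm (A : ℝ → E →L[ℝ] E) (y₀ : E) : ℕ → ℝ → E
  | 0 => fun _ => y₀
  | n + 1 => fun x => ∫ s in (0 : ℝ)..x, A s (picardTerm A y₀ n s)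

theorem continuous_picardTerm [CompleteSpace E] {A : ℝ → E →L[ℝ] E} (hA : Continuous A) (y₀ : E)
    (n : ℕ) : Continuous (picardTerm A y₀ n) := by
  induction n with
  | zero => exact continuous_const
  | succ n ih =>
    exact intervalIntegral.continuous_primitive
      (fun a b => (hA.clm_apply ih).intervalIntegrable a b) 0

theorem hasDerivAt_picardTerm_succ [CompleteSpace E] {A : ℝ → E →L[ℝ] E} (hA : Continuous A)
    (y₀ : E) (n : ℕ) (x : ℝ) :
    HasDerivAt (picardTerm A y₀ (n + 1)) (A x (picardTerm A y₀ n x)) x := by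
  have hc := hA.clm_apply (continuous_picardTerm hA y₀ n)
  exact intervalIntegral.integral_hasDerivAt_right (hc.intervalIntegrable _ _)
    hc.aestronglyMeasurable.stronglyMeasurableAtFilter hc.continuousAt

/-- Each integration of `|s| ^ n` contributes a factor `1 / (n + 1)`. The resulting factorial makes
the Picard series converge on every bounded interval, with no smallness condition. -/
theorem norm_picardTerm_le [CompleteSpace E] {A : ℝ → E →L[ℝ] E} (hA : Continuous A) (y₀ : E)
    {K R : ℝ} (hK : 0 ≤ K) (hAK : ∀ x, |x| ≤ R → ‖A x‖ ≤ K) (n : ℕ) (x : ℝ) (hx : |x| ≤ R) :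
    ‖picardTerm A y₀ n x‖ ≤ (K * |x|) ^ n / n.factorial * ‖y₀‖ := by
  induction n generalizing x with
  | zero => simp [picardTerm]
  | succ n ih =>
    have hc := hA.clm_apply (continuous_picardTerm hA y₀ n)
    calc ‖picardTerm A y₀ (n + 1) x‖
        ≤ ∫ s in Set.uIoc 0 x, ‖A s (picardTerm A y₀ n s)‖ :=
          intervalIntegral.norm_integral_le_integral_norm_uIoc
      _ ≤ ∫ s in Set.uIoc 0 x, (K ^ (n + 1) / n.factorial * ‖y₀‖) * |s - 0| ^ n := by
          have hint : ∀ g : ℝ → ℝ, Continuous g →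
              MeasureTheory.IntegrableOn g (Set.uIoc 0 x) := fun g hg =>
            (intervalIntegrable_iff.1 (hg.intervalIntegrable 0 x))
          refine MeasureTheory.setIntegral_mono_on (hint _ hc.norm)
            (hint _ (by fun_prop)) measurableSet_uIoc fun s hs => ?_
          have hs' : |s| ≤ |x| := by
            have := Set.abs_sub_left_of_mem_uIcc (Set.uIoc_subset_uIcc hs)
            simpa using this
          have h1 := ih s (hs'.trans hx)
          calc ‖A s (picardTerm A y₀ n s)‖ ≤ ‖A s‖ * ‖picardTerm A y₀ n s‖ :=
                (A s).le_opNorm _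
            _ ≤ K * ((K * |s|) ^ n / n.factorial * ‖y₀‖) :=
                mul_le_mul (hAK s (hs'.trans hx)) h1 (norm_nonneg _) hK
            _ = (K ^ (n + 1) / n.factorial * ‖y₀‖) * |s - 0| ^ n := by
                rw [sub_zero, mul_pow]; ring
      _ = (K * |x|) ^ (n + 1) / (n + 1).factorial * ‖y₀‖ := by
          rw [MeasureTheory.integral_const_mul, integral_pow_abs_sub_uIoc, sub_zero, mul_pow,
            Nat.factorial_succ]
          have : (n.factorial : ℝ) ≠ 0 := by positivity
          have : (n : ℝ) + 1 ≠ 0 := by positivity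
          push_cast
          field_simp

/-- A linear differential equation with continuous coefficients has global solutions. -/
theorem exists_hasDerivAt_linear [CompleteSpace E] {A : ℝ → E →L[ℝ] E} (hA : Continuous A)
    (y₀ : E) : ∃ Y : ℝ → E, Y 0 = y₀ ∧ ∀ x, HasDerivAt Y (A x (Y x)) x := by
  have key : ∀ R : ℝ, ∃ K, 0 ≤ K ∧ ∀ x, |x| ≤ R → ‖A x‖ ≤ K := by
    intro R
    obtain ⟨K, hK⟩ := (isCompact_Icc (a := -R) (b := R)).exists_bound_of_continuousOn
      hA.continuousOn
    refine ⟨max K 0, le_max_right _ _, fun x hx => (hK x ?_).trans (le_max_left _ _)⟩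
    exact abs_le.1 hx
  have hbound : ∀ R : ℝ, ∃ u : ℕ → ℝ, Summable u ∧
      ∀ n x, |x| ≤ R → ‖picardTerm A y₀ n x‖ ≤ u n := by
    intro R
    obtain ⟨K, hK, hAK⟩ := key R
    refine ⟨fun n => (K * R) ^ n / n.factorial * ‖y₀‖,
      (Real.summable_pow_div_factorial _).mul_right _, fun n x hx => ?_⟩
    refine (norm_picardTerm_le hA y₀ hK hAK n x hx).trans ?_
    have : (K * |x|) ^ n ≤ (K * R) ^ n := by gcongr
    show _ ≤ (K * R) ^ n / n.factorial * ‖y₀‖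
    gcongr
  have hsum : ∀ x, Summable fun n => picardTerm A y₀ n x := by
    intro x
    obtain ⟨u, hu, hb⟩ := hbound |x|
    exact Summable.of_norm_bounded hu fun n => hb n x le_rfl
  -- The constant zeroth term is split off because only the terms of index `n + 1` are primitives;
  -- their derivatives are `A` applied to the terms of index `n`, so the differentiated series is
  -- again the full one.
  refine ⟨fun x => y₀ + ∑' n, picardTerm A y₀ (n + 1) x, ?_, fun x => ?_⟩
  · simp [picardTerm]
  · have hYx : y₀ + ∑' n, picardTerm A y₀ (n + 1) x = ∑' n, picardTerm A y₀ n x := by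
      rw [(hsum x).tsum_eq_zero_add]; rfl
    obtain ⟨u, hu, hb⟩ := hbound (|x| + 1)
    obtain ⟨K, hK, hAK⟩ := key (|x| + 1)
    have h := hasDerivAt_tsum_of_isPreconnected (𝕜 := ℝ) (t := Metric.ball (0 : ℝ) (|x| + 1))
      (g := fun n => picardTerm A y₀ (n + 1)) (g' := fun n y => A y (picardTerm A y₀ n y))
      (y := x) (y₀ := 0) (hu.mul_left K) Metric.isOpen_ball (convex_ball _ _).isPreconnected
      (fun n y _ => hasDerivAt_picardTerm_succ hA y₀ n y)
      (fun n y hy => by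
        have hy' : |y| ≤ |x| + 1 := by
          rw [Metric.mem_ball, dist_zero_right, Real.norm_eq_abs] at hy; exact hy.le
        exact ((A y).le_opNorm _).trans
          (mul_le_mul (hAK y hy') (hb n y hy') (norm_nonneg _) hK))
      (by simp; positivity) ((summable_nat_add_iff 1).2 (hsum 0)) (by simp)
    have h2 := h.const_add y₀
    rw [← (A x).map_tsum (hsum x)] at h2
    beta_reduce
    rw [hYx]
    exact h2

/-- Gronwall's estimate for a function vanishing at the origin, on both sides of the origin. -/
theorem norm_le_of_norm_deriv_le {X X' : ℝ → E} {K ε R : ℝ} (hK : 0 < K) (hε : 0 ≤ ε)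
    (h0 : X 0 = 0) (hX : ∀ x, HasDerivAt X (X' x) x)
    (hb : ∀ x, |x| ≤ R → ‖X' x‖ ≤ K * ‖X x‖ + ε) (x : ℝ) (hx : |x| ≤ R) :
    ‖X x‖ ≤ (Real.exp (K * R) - 1) / K * ε := by
  have pos : ∀ {Z Z' : ℝ → E}, Z 0 = 0 → (∀ x, HasDerivAt Z (Z' x) x) →
      (∀ x, |x| ≤ R → ‖Z' x‖ ≤ K * ‖Z x‖ + ε) → ∀ x, 0 ≤ x → x ≤ R →
      ‖Z x‖ ≤ (Real.exp (K * R) - 1) / K * ε := by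
    intro Z Z' h0 hZ hb x hx0 hxR
    have h := norm_le_gronwallBound_of_norm_deriv_right_le (f := Z) (f' := Z') (δ := 0) (K := K)
      (ε := ε) (a := 0) (b := R) (fun y _ => (hZ y).continuousAt.continuousWithinAt)
      (fun y _ => (hZ y).hasDerivWithinAt) (by simp [h0])
      (fun y hy => hb y (abs_le.2 ⟨by linarith [hy.1, hy.2], hy.2.le⟩)) x ⟨hx0, hxR⟩
    rw [gronwallBound_of_K_ne_0 hK.ne'] at h
    refine h.trans ?_
    have : Real.exp (K * (x - 0)) ≤ Real.exp (K * R) := by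
      rw [sub_zero]; gcongr
    calc 0 * Real.exp (K * (x - 0)) + ε / K * (Real.exp (K * (x - 0)) - 1)
        = (Real.exp (K * (x - 0)) - 1) / K * ε := by ring
      _ ≤ _ := by gcongr
  rcases le_total 0 x with h | h
  · exact pos h0 hX hb x h ((le_abs_self x).trans hx)
  -- Negative `x` reduces to the positive side by the reflection `y ↦ -y`.
  · have := pos (Z := fun y => X (-y)) (Z' := fun y => -X' (-y)) (by simpa using h0)
      (fun y => by
        simpa [Function.comp_def] using (hX (-y)).scomp y (hasDerivAt_neg y))
      (fun y hy => by simpa using hb (-y) (by simpa using hy)) (-x) (by linarith)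
      ((neg_le_abs x).trans hx)
    simpa using this

end LinearODE

/-! ### Directional derivatives of smooth functions and their symmetry. -/

section DirectionalDerivative

variable {E : Type*} [NormedAddCommGroup E] [NormedSpace ℝ E]

/-- Derivative of `f` in the direction `v`, as a function. -/
noncomputable def dirDeriv (f : E → ℝ) (v : E) : E → ℝ := fun p => fderiv ℝ f p v

variable {f : E → ℝ} {Ω : Set E}

theorem ContDiffOn.dirDeriv (hf : ContDiffOn ℝ ∞ f Ω) (hΩ : IsOpen Ω) (v : E) :
    ContDiffOn ℝ ∞ (dirDeriv f v) Ω :=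
  (hf.fderiv_of_isOpen hΩ (by simp)).clm_apply contDiffOn_const

theorem dirDeriv_comm (hf : ContDiffOn ℝ ∞ f Ω) (hΩ : IsOpen Ω) {p : E} (hp : p ∈ Ω) (u v : E) :
    dirDeriv (dirDeriv f u) v p = dirDeriv (dirDeriv f v) u p := by
  have hfp : ContDiffAt ℝ ∞ f p := hf.contDiffAt (hΩ.mem_nhds hp)
  have hd : DifferentiableAt ℝ (fderiv ℝ f) p :=
    (hfp.fderiv_right (m := 1) (by norm_cast)).differentiableAt (by norm_num)
  have h : ∀ w, fderiv ℝ (dirDeriv f w) p = (fderiv ℝ (fderiv ℝ f) p).flip w := by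
    intro w
    have := (hd.hasFDerivAt.clm_apply (hasFDerivAt_const w p)).fderiv
    rw [show dirDeriv f w = fun y => fderiv ℝ f y w from rfl, this]
    ext z; simp
  have hs : IsSymmSndFDerivAt ℝ f p := hfp.isSymmSndFDerivAt
    (by rw [minSmoothness_of_isRCLikeNormedField]; exact WithTop.coe_le_coe.2 (le_top : (2 : ℕ∞) ≤ ⊤))
  show fderiv ℝ (dirDeriv f u) p v = fderiv ℝ (dirDeriv f v) p u
  rw [h, h]
  simpa using hs v u

/-- Two exchanges: the outer one at `p`, then one under a further derivative, which requires the
symmetry on a whole neighbourhood of `p`. -/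
theorem dirDeriv_dirDeriv_comm (hf : ContDiffOn ℝ ∞ f Ω) (hΩ : IsOpen Ω) {p : E} (hp : p ∈ Ω)
    (u v : E) : dirDeriv (dirDeriv (dirDeriv f u) u) v p =
      dirDeriv (dirDeriv (dirDeriv f v) u) u p := by
  rw [dirDeriv_comm (hf.dirDeriv hΩ u) hΩ hp]
  have : dirDeriv (dirDeriv f u) v =ᶠ[𝓝 p] dirDeriv (dirDeriv f v) u := by
    filter_upwards [hΩ.mem_nhds hp] with y hy using dirDeriv_comm hf hΩ hy u v
  show fderiv ℝ _ p u = fderiv ℝ _ p u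
  rw [this.fderiv_eq]

theorem hasDerivAt_dirDeriv_comp (hf : ContDiffOn ℝ ∞ f Ω) (hΩ : IsOpen Ω) {γ : ℝ → E} {v : E}
    {t : ℝ} (hp : γ t ∈ Ω) (hγ : HasDerivAt γ v t) :
    HasDerivAt (fun s => f (γ s)) (dirDeriv f v (γ t)) t :=
  (((hf.contDiffAt (hΩ.mem_nhds hp)).differentiableAt (by simp)).hasFDerivAt).comp_hasDerivAt t hγ

end DirectionalDerivative

/-! ### Differentiation under the integral sign. -/

section ParametricIntegral

/-- Differentiation under the integral sign over `[0, 1]` for smooth integrands. -/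
theorem hasDerivAt_integral_unitInterval {F F' : ℝ → ℝ → ℝ} {T : Set ℝ} (hT : IsOpen T) {t₀ : ℝ}
    (ht₀ : t₀ ∈ T) (hF : ∀ t ∈ T, Continuous (F t))
    (hF' : ContinuousOn (fun p : ℝ × ℝ => F' p.1 p.2) (T ×ˢ Set.univ))
    (hd : ∀ t ∈ T, ∀ s, HasDerivAt (fun t => F t s) (F' t s) t) :
    HasDerivAt (fun t => ∫ s in (0 : ℝ)..1, F t s) (∫ s in (0 : ℝ)..1, F' t₀ s) t₀ := by
  -- A closed ball inside `T` times `[0, 1]` is compact, so the continuous derivative is bounded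
  -- there by a constant, which serves as dominating function.
  obtain ⟨ε, hε, hball⟩ := Metric.isOpen_iff.1 hT t₀ ht₀
  have hsub : Metric.closedBall t₀ (ε / 2) ⊆ T :=
    (Metric.closedBall_subset_ball (by linarith)).trans hball
  obtain ⟨C, hC⟩ := ((isCompact_closedBall t₀ (ε / 2)).prod
    (isCompact_Icc (a := (0 : ℝ)) (b := 1))).exists_bound_of_continuousOn
    (hF'.mono (Set.prod_mono hsub (Set.subset_univ _)))
  have hF'c : Continuous (F' t₀) := by
    have : ContinuousOn (fun s : ℝ => F' t₀ s) Set.univ :=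
      hF'.comp (f := fun s : ℝ => (t₀, s)) (by fun_prop) (fun s _ => ⟨ht₀, trivial⟩)
    exact continuousOn_univ.1 this
  refine (intervalIntegral.hasDerivAt_integral_of_dominated_loc_of_deriv_le
    (F := F) (F' := F') (s := Metric.closedBall t₀ (ε / 2)) (bound := fun _ => C)
    (Metric.closedBall_mem_nhds t₀ (by linarith)) ?_ ((hF t₀ ht₀).intervalIntegrable _ _)
    hF'c.aestronglyMeasurable ?_ (by simp) ?_).2
  · filter_upwards [hT.mem_nhds ht₀] with t ht using (hF t ht).aestronglyMeasurable
  · refine Filter.Eventually.of_forall fun s hs t ht => hC (t, s) ⟨ht, ?_⟩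
    rw [Set.uIoc_of_le zero_le_one] at hs
    exact ⟨hs.1.le, hs.2⟩
  · exact Filter.Eventually.of_forall fun s _ t ht => hd t (hsub ht) s

end ParametricIntegral

/-! ### The profile equation and its variations. -/

/-- The profile family as a function on `ℝ × ℝ × ℝ`. -/
def uncurriedProfile (H : ℝ → ℝ → ℝ → ℝ) : ℝ × ℝ × ℝ → ℝ := fun p => H p.1 p.2.1 p.2.2

theorem deriv_fluxG_left {F h q : ℝ} (hh : h ≠ 0) :
    fluxG_h F h q = -q ^ 2 / h ^ 2 + h / F ^ 2 := by
  have h1 : HasDerivAt (fun z : ℝ => q ^ 2 / z + z ^ 2 / (2 * F ^ 2))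
      ((0 * h - q ^ 2 * 1) / h ^ 2 + (2 * h ^ (2 - 1) * 1) / (2 * F ^ 2)) h :=
    ((hasDerivAt_const h (q ^ 2)).div (hasDerivAt_id h) hh).add
      (((hasDerivAt_id h).pow 2).div_const _)
  show deriv (fun z : ℝ => q ^ 2 / z + z ^ 2 / (2 * F ^ 2)) h = _
  rw [h1.deriv]
  norm_num
  rw [mul_div_mul_left _ _ (by norm_num : (2 : ℝ) ≠ 0)]

theorem deriv_fluxG_right {F h q : ℝ} : fluxG_q F h q = 2 * q / h := by
  have h1 : HasDerivAt (fun z : ℝ => z ^ 2 / h + h ^ 2 / (2 * F ^ 2))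
      ((2 * q ^ (2 - 1) * 1) / h) q :=
    (((hasDerivAt_id q).pow 2).div_const _).add_const _
  show deriv (fun z : ℝ => z ^ 2 / h + h ^ 2 / (2 * F ^ 2)) q = _
  rw [h1.deriv]
  norm_num

theorem deriv_sourceS_left {h q : ℝ} (hh : h ≠ 0) :
    sourceS_h h q = 1 + 2 * q ^ 2 / h ^ 3 := by
  have h1 : HasDerivAt (fun z : ℝ => z - q ^ 2 / z ^ 2)
      (1 - (0 * h ^ 2 - q ^ 2 * (2 * h ^ (2 - 1) * 1)) / (h ^ 2) ^ 2) h :=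
    (hasDerivAt_id h).sub ((hasDerivAt_const h (q ^ 2)).div ((hasDerivAt_id h).pow 2)
      (pow_ne_zero 2 hh))
  show deriv (fun z : ℝ => z - q ^ 2 / z ^ 2) h = _
  rw [h1.deriv]
  field_simp
  ring

theorem deriv_sourceS_right {h q : ℝ} : sourceS_q h q = -2 * q / h ^ 2 := by
  have h1 : HasDerivAt (fun z : ℝ => h - z ^ 2 / h ^ 2) (-((2 * q ^ (2 - 1) * 1) / h ^ 2)) q :=
    (((hasDerivAt_id q).pow 2).div_const _).const_sub h
  show deriv (fun z : ℝ => h - z ^ 2 / h ^ 2) q = _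
  rw [h1.deriv]
  norm_num
  ring

namespace IsRollWaveFamily

variable {δ F : ℝ} {U : Set (ℝ × ℝ)} {L : ℝ → ℝ → ℝ} {H : ℝ → ℝ → ℝ → ℝ}

theorem isOpen_domain (hfam : IsRollWaveFamily δ F U L H) :
    IsOpen ((Set.univ : Set ℝ) ×ˢ U) := isOpen_univ.prod hfam.isOpen

theorem contDiffOn_uncurried (hfam : IsRollWaveFamily δ F U L H) :
    ContDiffOn ℝ ∞ (uncurriedProfile H) (Set.univ ×ˢ U) := hfam.smooth_H

/-- Smooth functions on the domain of the family are differentiable in the space variable. -/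
theorem hasDerivAt_space (hfam : IsRollWaveFamily δ F U L H) {g : ℝ × ℝ × ℝ → ℝ}
    (hg : ContDiffOn ℝ ∞ g (Set.univ ×ˢ U)) {c q : ℝ} (hU : (c, q) ∈ U) (x : ℝ) :
    HasDerivAt (fun y => g (y, c, q)) (dirDeriv g (1, 0, 0) (x, c, q)) x :=
  hasDerivAt_dirDeriv_comp (γ := fun y : ℝ => (y, c, q)) hg hfam.isOpen_domain ⟨trivial, hU⟩
    ((hasDerivAt_id x).prodMk (hasDerivAt_const x (c, q)))

theorem hasDerivAt_line (hfam : IsRollWaveFamily δ F U L H) {g : ℝ × ℝ × ℝ → ℝ}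
    (hg : ContDiffOn ℝ ∞ g (Set.univ ×ˢ U)) {c q : ℝ} (hU : (c, q) ∈ U) (x s a b : ℝ) :
    HasDerivAt (fun t : ℝ => g (x + t * s, c + t * a, q + t * b))
      (dirDeriv g (s, a, b) (x, c, q)) 0 := by
  have hγ : ∀ z w : ℝ, HasDerivAt (fun t : ℝ => z + t * w) w 0 := fun z w => by
    simpa using ((hasDerivAt_id (0 : ℝ)).mul_const w).const_add z
  have := hasDerivAt_dirDeriv_comp (γ := fun t : ℝ => (x + t * s, c + t * a, q + t * b))
    (t := 0) hg hfam.isOpen_domain ⟨trivial, by simpa using hU⟩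
    ((hγ x s).prodMk ((hγ c a).prodMk (hγ q b)))
  simpa using this

theorem uncurried_pos (hfam : IsRollWaveFamily δ F U L H) {p : ℝ × ℝ × ℝ}
    (hp : p ∈ (Set.univ : Set ℝ) ×ˢ U) : 0 < uncurriedProfile H p :=
  hfam.H_pos _ _ _ hp.2

theorem deriv_profile (hfam : IsRollWaveFamily δ F U L H) {c q : ℝ} (hU : (c, q) ∈ U) :
    deriv (fun x => H x c q) = fun x => dirDeriv (uncurriedProfile H) (1, 0, 0) (x, c, q) :=
  funext fun x => (hfam.hasDerivAt_space hfam.contDiffOn_uncurried hU x).deriv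

/-- The profile equation, solved for the highest order term. -/
theorem profile_eq (hfam : IsRollWaveFamily δ F U L H) {x c q : ℝ} (hU : (c, q) ∈ U) :
    δ * c * dirDeriv (dirDeriv (uncurriedProfile H) (1, 0, 0)) (1, 0, 0) (x, c, q) =
      (-q ^ 2 / uncurriedProfile H (x, c, q) ^ 2 + uncurriedProfile H (x, c, q) / F ^ 2) *
        dirDeriv (uncurriedProfile H) (1, 0, 0) (x, c, q) - uncurriedProfile H (x, c, q)
        + (c - q / uncurriedProfile H (x, c, q)) ^ 2 := by
  have h := hfam.profile c q hU x
  have hf := hfam.contDiffOn_uncurried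
  have hx := hfam.hasDerivAt_space hf hU x
  have hpos : uncurriedProfile H (x, c, q) ≠ 0 :=
    (hfam.uncurried_pos (p := (x, c, q)) ⟨trivial, hU⟩).ne'
  rw [hfam.deriv_profile hU,
    (hfam.hasDerivAt_space (hf.dirDeriv hfam.isOpen_domain _) hU x).deriv] at h
  have hfl := ((hasDerivAt_const x (q ^ 2)).div hx hpos).add ((hx.pow 2).div_const (2 * F ^ 2))
  have e : deriv (fun y => q ^ 2 / H y c q + H y c q ^ 2 / (2 * F ^ 2)) x = _ := hfl.deriv
  rw [e] at h
  have e2 : H x c q = uncurriedProfile H (x, c, q) := rfl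
  beta_reduce at h
  rw [e2] at h
  generalize uncurriedProfile H (x, c, q) = w at *
  generalize dirDeriv (uncurriedProfile H) (1, 0, 0) (x, c, q) = w1 at *
  -- The identity also holds for `F = 0`, where both sides vanish by the convention on division by
  -- zero.
  have e3 : (2 : ℕ) * w ^ (2 - 1) * w1 / (2 * F ^ 2) = w / F ^ 2 * w1 := by
    rcases eq_or_ne F 0 with rfl | hF0
    · simp
    · norm_num only [pow_one, Nat.cast_ofNat]; field_simp
  rw [e3] at h
  linear_combination h

/-- The profile equation, differentiated in the direction `(s, a, b)`. -/
theorem profile_variation (hfam : IsRollWaveFamily δ F U L H) {c q : ℝ} (hU : (c, q) ∈ U)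
    (x s a b : ℝ) {w w₁ w₂ v v₁ v₂ : ℝ} (hw : w = uncurriedProfile H (x, c, q))
    (hw₁ : w₁ = dirDeriv (uncurriedProfile H) (1, 0, 0) (x, c, q))
    (hw₂ : w₂ = dirDeriv (dirDeriv (uncurriedProfile H) (1, 0, 0)) (1, 0, 0) (x, c, q))
    (hv : v = dirDeriv (uncurriedProfile H) (s, a, b) (x, c, q))
    (hv₁ : v₁ = dirDeriv (dirDeriv (uncurriedProfile H) (s, a, b)) (1, 0, 0) (x, c, q))
    (hv₂ : v₂ = dirDeriv (dirDeriv (dirDeriv (uncurriedProfile H) (s, a, b)) (1, 0, 0)) (1, 0, 0)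
      (x, c, q)) :
    δ * a * w₂ + δ * c * v₂ =
      (-2 * q * b / w ^ 2 + 2 * q ^ 2 * v / w ^ 3 + v / F ^ 2) * w₁
        + (-q ^ 2 / w ^ 2 + w / F ^ 2) * v₁ - v
        + 2 * (c - q / w) * (a - b / w + q * v / w ^ 2) := by
  have hf := hfam.contDiffOn_uncurried
  have hO := hfam.isOpen_domain
  have hp : (x, c, q) ∈ (Set.univ : Set ℝ) ×ˢ U := ⟨trivial, hU⟩
  have hw0 : w ≠ 0 := hw ▸ (hfam.uncurried_pos hp).ne'
  have d0 := hfam.hasDerivAt_line hf hU x s a b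
  have d1 := hfam.hasDerivAt_line (hf.dirDeriv hO (1, 0, 0)) hU x s a b
  have d2 := hfam.hasDerivAt_line ((hf.dirDeriv hO (1, 0, 0)).dirDeriv hO (1, 0, 0)) hU x s a b
  -- Symmetry of derivatives: the variation of `∂ₓ²H` is `∂ₓ²` of the variation of `H`; the next
  -- line does the same for `∂ₓH`.
  rw [dirDeriv_dirDeriv_comm hf hO hp, ← hv₂] at d2
  rw [dirDeriv_comm hf hO hp, ← hv₁] at d1
  rw [← hv] at d0
  have dc : HasDerivAt (fun t : ℝ => c + t * a) a 0 := by
    simpa using ((hasDerivAt_id (0 : ℝ)).mul_const a).const_add c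
  have dq : HasDerivAt (fun t : ℝ => q + t * b) b 0 := by
    simpa using ((hasDerivAt_id (0 : ℝ)).mul_const b).const_add q
  have hne : uncurriedProfile H (x + 0 * s, c + 0 * a, q + 0 * b) ≠ 0 := by
    simpa [← hw] using hw0
  have lhs := (dc.const_mul δ).mul d2
  have rhs := ((((dq.pow 2).neg.div (d0.pow 2) (pow_ne_zero 2 hne)).add
    (d0.div_const (F ^ 2))).mul d1).sub d0 |>.add ((dc.sub (dq.div d0 hne)).pow 2)
  have hev : ∀ᶠ t : ℝ in 𝓝 0, (c + t * a, q + t * b) ∈ U := by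
    have : ContinuousAt (fun t : ℝ => (c + t * a, q + t * b)) 0 := by fun_prop
    exact this.eventually_mem (hfam.isOpen.mem_nhds (by simpa using hU))
  -- Since `U` is open, the profile equation holds along the whole line for small `t`; its two sides
  -- therefore have the same derivative at `t = 0`.
  have key := lhs.unique (rhs.congr_of_eventuallyEq (by
    filter_upwards [hev] with t ht using hfam.profile_eq ht))
  simp only [zero_mul, add_zero, ← hw, ← hw₁, ← hw₂, Pi.pow_apply, Pi.neg_apply, Pi.sub_apply,
    Pi.add_apply, Pi.div_apply] at key
  rw [key]
  norm_num only [pow_one, Nat.cast_ofNat]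
  rcases eq_or_ne F 0 with rfl | hF0
  · simp only [ne_eq, OfNat.ofNat_ne_zero, not_false_eq_true, zero_pow, div_zero]
    field_simp
    ring
  · field_simp
    ring

end IsRollWaveFamily

/-! ### Derivatives of the family as solutions of the first-order system. -/

/-- The coefficient of `λ` in `evansMatrix`. -/
noncomputable def evansSlope (δ F c qb : ℝ) (H : ℝ → ℝ) (x : ℝ) : Matrix (Fin 3) (Fin 3) ℂ :=
  !![0, -1, 0;
     0, 0, 0;
     ((1 / (δ * c) : ℝ) : ℂ), (((c - fluxG_q F (H x) (c * H x - qb)) / (δ * c) : ℝ) : ℂ),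
     ((δ / (δ * c) : ℝ) : ℂ)]

theorem evansMatrix_eq (δ F c qb : ℝ) (H : ℝ → ℝ) (lam : ℂ) (x : ℝ) :
    evansMatrix δ F c qb H lam x =
      evansMatrix δ F c qb H 0 x + lam • evansSlope δ F c qb H x := by
  ext i j
  fin_cases i <;> fin_cases j <;> simp [evansMatrix, evansSlope] <;> ring

/-- The derivative of the family of waves in the direction `(s, a, b)`, in the variables
`(q, h, h')` of the first order system. -/
noncomputable def variation (H : ℝ → ℝ → ℝ → ℝ) (c qb s a b x : ℝ) : Fin 3 → ℂ :=
  ![((c * dirDeriv (uncurriedProfile H) (s, a, b) (x, c, qb) + a * H x c qb - b : ℝ) : ℂ),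
    ((dirDeriv (uncurriedProfile H) (s, a, b) (x, c, qb) : ℝ) : ℂ),
    ((dirDeriv (dirDeriv (uncurriedProfile H) (s, a, b)) (1, 0, 0) (x, c, qb) : ℝ) : ℂ)]

/-- One derivative of the profile is needed because the last row contains the derivatives of `G_h`
and `G_q` along it. -/
theorem evansMatrix_continuous_of {δ F c qb : ℝ} {h : ℝ → ℝ} (hh : ContDiff ℝ 1 h)
    (hpos : ∀ x, h x ≠ 0) (lam : ℂ) : Continuous (evansMatrix δ F c qb h lam) := by
  have hc := hh.continuous
  have hGh : (fun y => fluxG_h F (h y) (c * h y - qb)) =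
      fun y => -(c * h y - qb) ^ 2 / h y ^ 2 + h y / F ^ 2 :=
    funext fun y => deriv_fluxG_left (hpos y)
  have hGq : (fun y => fluxG_q F (h y) (c * h y - qb)) = fun y => 2 * (c * h y - qb) / h y :=
    funext fun y => deriv_fluxG_right
  have hSh : ∀ y, sourceS_h (h y) (c * h y - qb) = 1 + 2 * (c * h y - qb) ^ 2 / h y ^ 3 :=
    fun y => deriv_sourceS_left (hpos y)
  have hSq : ∀ y, sourceS_q (h y) (c * h y - qb) = -2 * (c * h y - qb) / h y ^ 2 :=
    fun y => deriv_sourceS_right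
  have hp2 : ∀ x, h x ^ 2 ≠ 0 := fun x => pow_ne_zero 2 (hpos x)
  have hp3 : ∀ x, h x ^ 3 ≠ 0 := fun x => pow_ne_zero 3 (hpos x)
  have cGh : ContDiff ℝ 1 (fun y => fluxG_h F (h y) (c * h y - qb)) := by
    rw [hGh]
    exact ((((contDiff_const.mul hh).sub contDiff_const).pow 2).neg.div (hh.pow 2) hp2).add
      (hh.div_const _)
  have cGq : ContDiff ℝ 1 (fun y => fluxG_q F (h y) (c * h y - qb)) := by
    rw [hGq]
    exact (contDiff_const.mul ((contDiff_const.mul hh).sub contDiff_const)).div hh hpos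
  have cGh' := cGh.continuous_deriv le_rfl
  have cGq' := cGq.continuous_deriv le_rfl
  have cGh0 := cGh.continuous
  have cGq0 := cGq.continuous
  have cSh : Continuous fun y => sourceS_h (h y) (c * h y - qb) := by
    simp only [hSh]; fun_prop (disch := assumption)
  have cSq : Continuous fun y => sourceS_q (h y) (c * h y - qb) := by
    simp only [hSq]; fun_prop (disch := assumption)
  refine continuous_matrix fun i j => ?_
  fin_cases i <;> fin_cases j <;>
    simp only [evansMatrix, Matrix.of_apply, Matrix.cons_val', Matrix.cons_val_zero,
      Matrix.cons_val_one, Matrix.cons_val, Fin.zero_eta, Fin.mk_one, Fin.reduceFinMk,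
      Matrix.cons_val_fin_one] <;> fun_prop

namespace IsRollWaveFamily

variable {δ F : ℝ} {U : Set (ℝ × ℝ)} {L : ℝ → ℝ → ℝ} {H : ℝ → ℝ → ℝ → ℝ}

theorem contDiff_slice (_hfam : IsRollWaveFamily δ F U L H) {g : ℝ × ℝ × ℝ → ℝ}
    (hg : ContDiffOn ℝ ∞ g (Set.univ ×ˢ U)) {c q : ℝ} (hU : (c, q) ∈ U) :
    ContDiff ℝ ∞ fun x => g (x, c, q) :=
  contDiffOn_univ.1 <| hg.comp (f := fun x : ℝ => (x, c, q)) (by fun_prop)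
    fun _ _ => ⟨trivial, hU⟩

theorem continuous_evansMatrix (hfam : IsRollWaveFamily δ F U L H) {c q : ℝ} (hU : (c, q) ∈ U)
    (lam : ℂ) : Continuous (evansMatrix δ F c q (fun x => H x c q) lam) :=
  evansMatrix_continuous_of ((hfam.contDiff_slice hfam.contDiffOn_uncurried hU).of_le (by simp))
    (fun x => (hfam.H_pos x c q hU).ne') lam

theorem continuous_evansSlope (hfam : IsRollWaveFamily δ F U L H) {c q : ℝ} (hU : (c, q) ∈ U) :
    Continuous (evansSlope δ F c q (fun x => H x c q)) := by
  have : evansSlope δ F c q (fun x => H x c q) = fun x =>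
      evansMatrix δ F c q (fun x => H x c q) 1 x - evansMatrix δ F c q (fun x => H x c q) 0 x := by
    funext x
    rw [evansMatrix_eq _ _ _ _ _ 1]; simp
  rw [this]
  exact (hfam.continuous_evansMatrix hU 1).sub (hfam.continuous_evansMatrix hU 0)

/-- Every derivative of the family solves the linearized equations, up to the forcing coming from
the variation of the speed. -/
theorem hasDerivAt_variation (hfam : IsRollWaveFamily δ F U L H) (hδ : δ ≠ 0) (hF : F ≠ 0) {c q : ℝ}
    (hU : (c, q) ∈ U) (hc : c ≠ 0) (s a b x : ℝ) :
    HasDerivAt (variation H c q s a b)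
      ((evansMatrix δ F c q (fun x => H x c q) 0 x).mulVec (variation H c q s a b x)
        - (a : ℂ) • (evansSlope δ F c q (fun x => H x c q) x).mulVec (variation H c q 1 0 0 x))
      x := by
  have hf := hfam.contDiffOn_uncurried
  have hO := hfam.isOpen_domain
  have d0 := hfam.hasDerivAt_space hf hU x
  have dv := hfam.hasDerivAt_space (hf.dirDeriv hO (s, a, b)) hU x
  have dv1 := hfam.hasDerivAt_space ((hf.dirDeriv hO (s, a, b)).dirDeriv hO (1, 0, 0)) hU x
  have hvar := hfam.profile_variation hU x s a b rfl rfl rfl rfl rfl rfl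
  have hpos : ∀ y, H y c q ≠ 0 := fun y => (hfam.H_pos y c q hU).ne'
  have hGh : (fun y => fluxG_h F (H y c q) (c * H y c q - q)) =
      fun y => -(c * H y c q - q) ^ 2 / H y c q ^ 2 + H y c q / F ^ 2 :=
    funext fun y => deriv_fluxG_left (hpos y)
  have d0' : HasDerivAt (fun y => H y c q)
      (dirDeriv (uncurriedProfile H) (1, 0, 0) (x, c, q)) x := d0
  have dGh := (((d0'.const_mul c).sub_const q).pow 2).neg.div (d0'.pow 2)
    (pow_ne_zero 2 (hpos x)) |>.add (d0'.div_const (F ^ 2))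
  have dGq := (((d0'.const_mul c).sub_const q).const_mul 2).div d0' (hpos x)
  have eGh : deriv (fun y => -(c * H y c q - q) ^ 2 / H y c q ^ 2 + H y c q / F ^ 2) x = _ :=
    dGh.deriv
  have eGq : deriv (fun y => 2 * (c * H y c q - q) / H y c q) x = _ := dGq.deriv
  rw [hasDerivAt_pi]
  intro i
  simp only [Pi.pow_apply, Pi.neg_apply, pow_one, Nat.cast_ofNat, Nat.add_one_sub_one] at eGh
  fin_cases i
  · have := (((dv.const_mul c).add (d0.const_mul a)).sub_const b).ofReal_comp
    refine this.congr_deriv ?_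

    simp [variation, evansMatrix, evansSlope]
    ring
  · have := dv.ofReal_comp
    refine this.congr_deriv ?_

    simp [variation, evansMatrix, evansSlope]
  · have := dv1.ofReal_comp
    refine this.congr_deriv ?_
    have e0 : uncurriedProfile H (x, c, q) = H x c q := rfl
    rw [e0] at hvar
    have hx := hpos x
    simp [variation, evansMatrix, evansSlope, hGh, eGh, eGq, deriv_fluxG_left (hpos x), deriv_fluxG_right, deriv_sourceS_left (hpos x),
      deriv_sourceS_right]
    generalize H x c q = w at *
    generalize dirDeriv (uncurriedProfile H) (1, 0, 0) (x, c, q) = w₁ at *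
    generalize dirDeriv (dirDeriv (uncurriedProfile H) (1, 0, 0)) (1, 0, 0) (x, c, q) = w₂ at *
    generalize dirDeriv (uncurriedProfile H) (s, a, b) (x, c, q) = v at *
    generalize dirDeriv (dirDeriv (uncurriedProfile H) (s, a, b)) (1, 0, 0) (x, c, q) = v₁ at *
    generalize dirDeriv (dirDeriv (dirDeriv (uncurriedProfile H) (s, a, b)) (1, 0, 0)) (1, 0, 0)
      (x, c, q) = v₂ at *
    -- The varied profile equation is solved for its highest derivative; the last component then
    -- becomes a rational identity.
    have hv2 : v₂ = (((-2 * q * b / w ^ 2 + 2 * q ^ 2 * v / w ^ 3 + v / F ^ 2) * w₁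
        + (-q ^ 2 / w ^ 2 + w / F ^ 2) * v₁ - v
        + 2 * (c - q / w) * (a - b / w + q * v / w ^ 2)) - δ * a * w₂) / (δ * c) := by
      rw [← hvar]; field_simp; ring
    have hw' : (w : ℂ) ≠ 0 := Complex.ofReal_ne_zero.2 hx
    have hδ' : (δ : ℂ) ≠ 0 := Complex.ofReal_ne_zero.2 hδ
    have hc' : (c : ℂ) ≠ 0 := Complex.ofReal_ne_zero.2 hc
    have hF' : (F : ℂ) ≠ 0 := Complex.ofReal_ne_zero.2 hF
    rw [hv2]
    push_cast
    field_simp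
    ring

end IsRollWaveFamily

/-! ### Dependence of the period, of the end values and of the mean on the parameters. -/

section Parameters

theorem hasDerivAt_fst_of_line {f : ℝ → ℝ → ℝ} {c q d : ℝ}
    (h : HasDerivAt (fun t : ℝ => f (c + t * 1) (q + t * 0)) d 0) :
    HasDerivAt (fun z => f z q) d c := by
  have h' : HasDerivAt (fun t : ℝ => f (c + t * 1) (q + t * 0)) d (c - c) := by rwa [sub_self]
  have := h'.comp_sub_const c c
  simpa using this

theorem hasDerivAt_snd_of_line {f : ℝ → ℝ → ℝ} {c q d : ℝ}
    (h : HasDerivAt (fun t : ℝ => f (c + t * 0) (q + t * 1)) d 0) :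
    HasDerivAt (fun z => f c z) d q := by
  have h' : HasDerivAt (fun t : ℝ => f (c + t * 0) (q + t * 1)) d (q - q) := by rwa [sub_self]
  have := h'.comp_sub_const q q
  simpa using this

theorem dirDeriv_eq_add {g : ℝ × ℝ × ℝ → ℝ} (p : ℝ × ℝ × ℝ) (s a b : ℝ) :
    dirDeriv g (s, a, b) p = s * dirDeriv g (1, 0, 0) p + dirDeriv g (0, a, b) p := by
  have : ((s, a, b) : ℝ × ℝ × ℝ) = s • (1, 0, 0) + (0, a, b) := by simp
  simp only [dirDeriv]
  rw [this, map_add, map_smul, smul_eq_mul]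

end Parameters

namespace IsRollWaveFamily

variable {δ F : ℝ} {U : Set (ℝ × ℝ)} {L : ℝ → ℝ → ℝ} {H : ℝ → ℝ → ℝ → ℝ}

theorem hasDerivAt_period_fderiv (hfam : IsRollWaveFamily δ F U L H) {c q : ℝ}
    (a b : ℝ) {t : ℝ} (ht : (c + t * a, q + t * b) ∈ U) :
    HasDerivAt (fun t : ℝ => L (c + t * a) (q + t * b))
      (fderiv ℝ (fun p : ℝ × ℝ => L p.1 p.2) (c + t * a, q + t * b) (a, b)) t := by
  have hγ : ∀ z w : ℝ, HasDerivAt (fun t : ℝ => z + t * w) w t := fun z w => by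
    simpa using ((hasDerivAt_id t).mul_const w).const_add z
  exact hasDerivAt_dirDeriv_comp (γ := fun t : ℝ => (c + t * a, q + t * b)) hfam.smooth_L
    hfam.isOpen ht ((hγ c a).prodMk (hγ q b))

theorem fderiv_period (hfam : IsRollWaveFamily δ F U L H) {c q : ℝ} (hU : (c, q) ∈ U)
    (a b : ℝ) :
    fderiv ℝ (fun p : ℝ × ℝ => L p.1 p.2) (c, q) (a, b) = a * dc L c q + b * dq L c q := by
  have hc := hfam.hasDerivAt_period_fderiv 1 0 (t := 0) (by simpa using hU)
  have hq := hfam.hasDerivAt_period_fderiv 0 1 (t := 0) (by simpa using hU)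
  have e : ((a, b) : ℝ × ℝ) = a • (1, 0) + b • (0, 1) := by simp
  rw [dc, dq, (hasDerivAt_fst_of_line hc).deriv, (hasDerivAt_snd_of_line hq).deriv, e, map_add,
    map_smul, map_smul]
  simp

theorem hasDerivAt_period (hfam : IsRollWaveFamily δ F U L H) {c q : ℝ} (hU : (c, q) ∈ U)
    (a b : ℝ) : HasDerivAt (fun t : ℝ => L (c + t * a) (q + t * b))
      (a * dc L c q + b * dq L c q) 0 := by
  have := hfam.hasDerivAt_period_fderiv a b (t := 0) (by simpa using hU)
  rw [← hfam.fderiv_period hU]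
  simpa using this

/-- Smooth functions of constant value over periods, differentiated in the direction `(a, b)` of
the parameters. -/
theorem dirDeriv_at_period (hfam : IsRollWaveFamily δ F U L H) {g : ℝ × ℝ × ℝ → ℝ}
    (hg : ContDiffOn ℝ ∞ g (Set.univ ×ˢ U))
    (hper : ∀ c q, (c, q) ∈ U → g (L c q, c, q) = g (0, c, q)) {c q : ℝ} (hU : (c, q) ∈ U)
    (a b : ℝ) :
    dirDeriv g (0, a, b) (L c q, c, q) = dirDeriv g (0, a, b) (0, c, q)
      - (a * dc L c q + b * dq L c q) * dirDeriv g (1, 0, 0) (L c q, c, q) := by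
  have hγ : ∀ z w : ℝ, HasDerivAt (fun t : ℝ => z + t * w) w 0 := fun z w => by
    simpa using ((hasDerivAt_id (0 : ℝ)).mul_const w).const_add z
  have h1 := hasDerivAt_dirDeriv_comp
    (γ := fun t : ℝ => (L (c + t * a) (q + t * b), c + t * a, q + t * b)) (t := 0) hg
    hfam.isOpen_domain ⟨trivial, by simpa using hU⟩
    ((hfam.hasDerivAt_period hU a b).prodMk ((hγ c a).prodMk (hγ q b)))
  have h0 := hfam.hasDerivAt_line hg hU 0 0 a b
  have hev : ∀ᶠ t : ℝ in 𝓝 0, (c + t * a, q + t * b) ∈ U := by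
    have : ContinuousAt (fun t : ℝ => (c + t * a, q + t * b)) 0 := by fun_prop
    exact this.eventually_mem (hfam.isOpen.mem_nhds (by simpa using hU))
  have key := h1.unique (h0.congr_of_eventuallyEq (by
    filter_upwards [hev] with t ht
    simpa using hper _ _ ht))
  -- The moving endpoint `L(c, q)` contributes `dL` times the space derivative; the remainder is the
  -- derivative in the parameters alone.
  rw [dirDeriv_eq_add] at key
  simp only [zero_mul, add_zero] at key
  linarith

theorem periodic_dirDeriv_space (hfam : IsRollWaveFamily δ F U L H) {g : ℝ × ℝ × ℝ → ℝ}
    (hg : ContDiffOn ℝ ∞ g (Set.univ ×ˢ U)) {c q : ℝ} (hU : (c, q) ∈ U)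
    (hper : ∀ x, g (x + L c q, c, q) = g (x, c, q)) (x : ℝ) :
    dirDeriv g (1, 0, 0) (x + L c q, c, q) = dirDeriv g (1, 0, 0) (x, c, q) := by
  have h1 := (hfam.hasDerivAt_space hg hU (x + L c q)).comp_add_const x (L c q)
  simp only [hper] at h1
  exact h1.unique (hfam.hasDerivAt_space hg hU x)

theorem uncurried_periodic (hfam : IsRollWaveFamily δ F U L H) {c q : ℝ} (hU : (c, q) ∈ U)
    (x : ℝ) : uncurriedProfile H (x + L c q, c, q) = uncurriedProfile H (x, c, q) :=
  hfam.periodic c q hU x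

theorem variation_space_at_period (hfam : IsRollWaveFamily δ F U L H) {c q : ℝ}
    (hU : (c, q) ∈ U) :
    variation H c q 1 0 0 (L c q) = variation H c q 1 0 0 0 := by
  have hf := hfam.contDiffOn_uncurried
  have h1 := hfam.periodic_dirDeriv_space hf hU (hfam.uncurried_periodic hU)
  have h2 := hfam.periodic_dirDeriv_space (hf.dirDeriv hfam.isOpen_domain (1, 0, 0)) hU h1
  have h1 := h1 0
  have h2 := h2 0
  rw [zero_add] at h1 h2
  simp [variation, h1, h2]

/-- Differentiating `H(L) = H(0)` and `H'(L) = H'(0)` in the parameters leaves a defect along the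
translation mode. It produces the entries `∂L` in the dispersion relation. -/
theorem variation_parameter_at_period (hfam : IsRollWaveFamily δ F U L H) {c q : ℝ}
    (hU : (c, q) ∈ U) (a b : ℝ) :
    variation H c q 0 a b (L c q) = variation H c q 0 a b 0
      - ((a * dc L c q + b * dq L c q : ℝ) : ℂ) • variation H c q 1 0 0 0 := by
  have hf := hfam.contDiffOn_uncurried
  have hO := hfam.isOpen_domain
  have hper : ∀ c q, (c, q) ∈ U →
      uncurriedProfile H (L c q, c, q) = uncurriedProfile H (0, c, q) := fun c q h => by
    simpa using hfam.uncurried_periodic h 0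
  have hper1 : ∀ c q, (c, q) ∈ U → dirDeriv (uncurriedProfile H) (1, 0, 0) (L c q, c, q) =
      dirDeriv (uncurriedProfile H) (1, 0, 0) (0, c, q) := fun c q h => by
    simpa using hfam.periodic_dirDeriv_space hf h (hfam.uncurried_periodic h) 0
  have h0 : H (L c q) c q = H 0 c q := hper c q hU
  have h1 := hfam.dirDeriv_at_period hf hper hU a b
  have h2 := hfam.dirDeriv_at_period (hf.dirDeriv hO (1, 0, 0)) hper1 hU a b
  have h3 := hfam.periodic_dirDeriv_space (hf.dirDeriv hO (1, 0, 0)) hU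
    (hfam.periodic_dirDeriv_space hf hU (hfam.uncurried_periodic hU)) 0
  rw [zero_add] at h3
  rw [hper1 c q hU] at h1
  -- `h2` concerns the parameter derivative of `∂ₓH`, whereas the third component of `variation` is
  -- `∂ₓ` of the parameter derivative.
  rw [dirDeriv_comm hf hO (p := (L c q, c, q)) ⟨trivial, hU⟩ (1, 0, 0) (0, a, b),
    dirDeriv_comm hf hO (p := (0, c, q)) ⟨trivial, hU⟩ (1, 0, 0) (0, a, b), h3] at h2
  ext i
  fin_cases i
  · simp [variation, h1, h0]; ring
  · simp [variation, h1]
  · simp [variation, h2]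

/-- Rescaling to a fixed interval moves all dependence on the parameters into the integrand. -/
theorem massM_eq_unit (hfam : IsRollWaveFamily δ F U L H) {c q : ℝ} (hU : (c, q) ∈ U) :
    massM L H c q = ∫ s in (0 : ℝ)..1, H (L c q * s) c q := by
  have := intervalIntegral.integral_comp_mul_left (a := 0) (b := 1) (fun x => H x c q)
    (hfam.L_ne_zero c q hU)
  rw [this, mul_zero, mul_one, massM, meanL, smul_eq_mul, one_div]

/-- The first term records the position of the origin on the wave: it comes from the varying period
and disappears when `H(0) = M`. -/
theorem hasDerivAt_massM_line (hfam : IsRollWaveFamily δ F U L H) {c q : ℝ} (hU : (c, q) ∈ U)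
    (a b : ℝ) : HasDerivAt (fun t : ℝ => massM L H (c + t * a) (q + t * b))
      ((a * dc L c q + b * dq L c q) / L c q * (H 0 c q - massM L H c q)
        + meanL (L c q) fun x => dirDeriv (uncurriedProfile H) (0, a, b) (x, c, q)) 0 := by
  have hf := hfam.contDiffOn_uncurried
  have hO := hfam.isOpen_domain
  have hL := hfam.L_ne_zero c q hU
  have hγ : ∀ z w t : ℝ, HasDerivAt (fun t : ℝ => z + t * w) w t := fun z w t => by
    simpa using ((hasDerivAt_id t).mul_const w).const_add z
  set T : Set ℝ := (fun t : ℝ => (c + t * a, q + t * b)) ⁻¹' U with hTdef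
  have hT : IsOpen T := hfam.isOpen.preimage (by fun_prop)
  have h0T : (0 : ℝ) ∈ T := by simpa [hTdef] using hU
  set dL : ℝ → ℝ := fun t =>
    fderiv ℝ (fun p : ℝ × ℝ => L p.1 p.2) (c + t * a, q + t * b) (a, b) with hdL
  set G : ℝ → ℝ → ℝ × ℝ × ℝ := fun t s =>
    (L (c + t * a) (q + t * b) * s, c + t * a, q + t * b) with hG
  have hLT : ContinuousOn (fun t : ℝ => L (c + t * a) (q + t * b)) T :=
    hfam.smooth_L.continuousOn.comp (f := fun t : ℝ => (c + t * a, q + t * b))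
      (by fun_prop) fun t ht => ht
  have hdLT : ContinuousOn dL T :=
    (hfam.smooth_L.dirDeriv hfam.isOpen (a, b)).continuousOn.comp
      (f := fun t : ℝ => (c + t * a, q + t * b)) (by fun_prop) fun t ht => ht
  have hfst : ContinuousOn (fun p : ℝ × ℝ => p.1) (T ×ˢ Set.univ) := continuous_fst.continuousOn
  have hGc : ContinuousOn (fun p : ℝ × ℝ => G p.1 p.2) (T ×ˢ Set.univ) := by
    have := hLT.comp hfst fun p hp => hp.1
    exact (this.mul continuous_snd.continuousOn).prodMk (by fun_prop)
  have hGm : ∀ p ∈ T ×ˢ (Set.univ : Set ℝ), G p.1 p.2 ∈ (Set.univ : Set ℝ) ×ˢ U :=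
    fun p hp => ⟨trivial, hp.1⟩
  have hd : ∀ t ∈ T, ∀ s, HasDerivAt (fun t => uncurriedProfile H (G t s))
      (dL t * s * dirDeriv (uncurriedProfile H) (1, 0, 0) (G t s)
        + dirDeriv (uncurriedProfile H) (0, a, b) (G t s)) t := by
    intro t ht s
    rw [← dirDeriv_eq_add]
    exact hasDerivAt_dirDeriv_comp (γ := fun t => G t s) hf hO ⟨trivial, ht⟩
      (((hfam.hasDerivAt_period_fderiv a b ht).mul_const s).prodMk
        ((hγ c a t).prodMk (hγ q b t)))
  have main := hasDerivAt_integral_unitInterval (F := fun t s => uncurriedProfile H (G t s)) hT h0T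
    (fun t ht => ((hfam.contDiff_slice hf ht).continuous.comp
      (continuous_const.mul continuous_id)))
    (by
      have k1 := hdLT.comp hfst fun p hp => hp.1
      have k2 := (hf.dirDeriv hO (1, 0, 0)).continuousOn.comp hGc hGm
      have k3 := (hf.dirDeriv hO (0, a, b)).continuousOn.comp hGc hGm
      exact ((k1.mul continuous_snd.continuousOn).mul k2).add k3) hd
  have hev : ∀ᶠ t : ℝ in 𝓝 0, t ∈ T := hT.mem_nhds h0T
  refine (main.congr_of_eventuallyEq ?_).congr_deriv ?_
  · filter_upwards [hev] with t ht using hfam.massM_eq_unit ht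
  · have hdL0 : dL 0 = a * dc L c q + b * dq L c q := by
      rw [hdL, ← hfam.fderiv_period hU]; simp
    have hG0 : ∀ s, G 0 s = (L c q * s, c, q) := fun s => by simp [hG]
    simp only [hG0, hdL0]
    have cx := (hfam.contDiff_slice (hf.dirDeriv hO (1, 0, 0)) hU).continuous.comp
      (continuous_const_mul (L c q))
    have cv := (hfam.contDiff_slice (hf.dirDeriv hO (0, a, b)) hU).continuous.comp
      (continuous_const_mul (L c q))
    have ch := (hfam.contDiff_slice hf hU).continuous.comp (continuous_const_mul (L c q))
    simp only [Function.comp_def] at cx cv ch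
    -- Integration by parts: the integrand is the derivative of `s H(L s)`. This evaluates the term
    -- `dL ∫ s H'(L s)` as `(dL / L) (H(0) - M)`.
    have parts : ∫ s in (0 : ℝ)..1, (uncurriedProfile H (L c q * s, c, q)
        + s * (dirDeriv (uncurriedProfile H) (1, 0, 0) (L c q * s, c, q) * L c q)) = H 0 c q := by
      rw [intervalIntegral.integral_eq_sub_of_hasDerivAt
        (f := fun s => s * uncurriedProfile H (L c q * s, c, q))]
      · have := hfam.uncurried_periodic hU 0
        rw [zero_add] at this
        simp [this]; rfl
      · intro s _
        have e : HasDerivAt (fun s => L c q * s) (L c q) s := by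
          simpa using (hasDerivAt_id s).const_mul (L c q)
        have := (hasDerivAt_id s).mul ((hfam.hasDerivAt_space hf hU (L c q * s)).comp s e)
        simpa [Function.comp_def, Pi.mul_def] using this
      · exact (ch.add (continuous_id.mul (cx.mul continuous_const))).intervalIntegrable _ _
    have hmean : (meanL (L c q) fun x => dirDeriv (uncurriedProfile H) (0, a, b) (x, c, q)) =
        ∫ s in (0 : ℝ)..1, dirDeriv (uncurriedProfile H) (0, a, b) (L c q * s, c, q) := by
      rw [intervalIntegral.integral_comp_mul_left
        (fun x => dirDeriv (uncurriedProfile H) (0, a, b) (x, c, q)) hL, mul_zero, mul_one, meanL,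
        smul_eq_mul, one_div]
    have csx : Continuous fun s : ℝ =>
        s * (dirDeriv (uncurriedProfile H) (1, 0, 0) (L c q * s, c, q) * L c q) :=
      continuous_id.mul (cx.mul continuous_const)
    have csx' : Continuous fun s : ℝ => (a * dc L c q + b * dq L c q) * s *
        dirDeriv (uncurriedProfile H) (1, 0, 0) (L c q * s, c, q) :=
      (continuous_const.mul continuous_id).mul cx
    rw [intervalIntegral.integral_add (ch.intervalIntegrable _ _)
      (csx.intervalIntegrable _ _)] at parts
    have hM : ∫ s in (0 : ℝ)..1, uncurriedProfile H (L c q * s, c, q) = massM L H c q :=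
      (hfam.massM_eq_unit hU).symm
    rw [hM] at parts
    rw [hmean, intervalIntegral.integral_add
      (csx'.intervalIntegrable _ _)
      (cv.intervalIntegrable _ _), ← parts, add_sub_cancel_left,
      ← intervalIntegral.integral_const_mul]
    congr 1
    refine intervalIntegral.integral_congr fun s _ => ?_
    field_simp

theorem dc_profile (hfam : IsRollWaveFamily δ F U L H) {c q : ℝ} (hU : (c, q) ∈ U) (x : ℝ) :
    dc (H x) c q = dirDeriv (uncurriedProfile H) (0, 1, 0) (x, c, q) := by
  have := hfam.hasDerivAt_line hfam.contDiffOn_uncurried hU x 0 1 0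
  simp only [mul_zero, add_zero] at this
  exact (hasDerivAt_fst_of_line (f := H x) (by simpa [uncurriedProfile] using this)).deriv

theorem dq_profile (hfam : IsRollWaveFamily δ F U L H) {c q : ℝ} (hU : (c, q) ∈ U) (x : ℝ) :
    dq (H x) c q = dirDeriv (uncurriedProfile H) (0, 0, 1) (x, c, q) := by
  have := hfam.hasDerivAt_line hfam.contDiffOn_uncurried hU x 0 0 1
  simp only [mul_zero, add_zero] at this
  exact (hasDerivAt_snd_of_line (f := H x) (by simpa [uncurriedProfile] using this)).deriv

theorem hasDerivAt_massM_fst (hfam : IsRollWaveFamily δ F U L H) {c q : ℝ} (hU : (c, q) ∈ U) :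
    HasDerivAt (fun z => massM L H z q) (dc L c q / L c q * (H 0 c q - massM L H c q)
      + meanL (L c q) fun x => dc (H x) c q) c := by
  simp only [hfam.dc_profile hU]
  simpa using hasDerivAt_fst_of_line (hfam.hasDerivAt_massM_line hU 1 0)

theorem hasDerivAt_massM_snd (hfam : IsRollWaveFamily δ F U L H) {c q : ℝ} (hU : (c, q) ∈ U) :
    HasDerivAt (fun z => massM L H c z) (dq L c q / L c q * (H 0 c q - massM L H c q)
      + meanL (L c q) fun x => dq (H x) c q) q := by
  simp only [hfam.dq_profile hU]
  simpa using hasDerivAt_snd_of_line (hfam.hasDerivAt_massM_line hU 0 1)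

end IsRollWaveFamily

/-! ### Resolvent matrices and approximate solutions of 3×3 systems. -/

section LinearSystems

/-- A complex matrix as a real continuous linear map. -/
noncomputable def mulVecCLM (M : Matrix (Fin 3) (Fin 3) ℂ) : (Fin 3 → ℂ) →L[ℝ] (Fin 3 → ℂ) :=
  (LinearMap.toContinuousLinearMap (Matrix.toLin' M)).restrictScalars ℝ

theorem mulVecCLM_apply (M : Matrix (Fin 3) (Fin 3) ℂ) (v : Fin 3 → ℂ) :
    mulVecCLM M v = M.mulVec v := by
  simp [mulVecCLM]

theorem continuous_mulVecCLM : Continuous mulVecCLM := by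
  have h : Continuous ((LinearMap.toContinuousLinearMap (𝕜 := ℂ) (E := Fin 3 → ℂ)
      (F' := Fin 3 → ℂ)).toLinearMap ∘ₗ (Matrix.toLin' (R := ℂ) (m := Fin 3)
      (n := Fin 3)).toLinearMap) := LinearMap.continuous_of_finiteDimensional _
  exact (ContinuousLinearMap.continuous_restrictScalars ℝ).comp h

/-- `resolventMatrix` takes the value `0` when no resolvent exists; this excludes that case. The
columns solve the system from the unit vectors. -/
theorem exists_isResolvent {A : ℝ → Matrix (Fin 3) (Fin 3) ℂ} (hA : Continuous A) :
    ∃ Ψ, IsResolvent A Ψ := by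
  choose Y hY0 hY using fun j : Fin 3 =>
    exists_hasDerivAt_linear (continuous_mulVecCLM.comp hA) (Pi.single j (1 : ℂ))
  refine ⟨fun x => Matrix.of fun i j => Y j x i, ?_, fun x i j => ?_⟩
  · ext i j
    simp only [Matrix.of_apply, hY0, Matrix.one_apply, Pi.single_apply]
  · have := hasDerivAt_pi.1 (hY j x) i
    rw [Function.comp_apply, mulVecCLM_apply] at this
    exact this

theorem isResolvent_resolventMatrix {A : ℝ → Matrix (Fin 3) (Fin 3) ℂ} (hA : Continuous A) :
    IsResolvent A (resolventMatrix A) := by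
  have h := exists_isResolvent hA
  rw [resolventMatrix, dif_pos h]
  exact h.choose_spec

theorem IsResolvent.hasDerivAt_mulVec {A Ψ : ℝ → Matrix (Fin 3) (Fin 3) ℂ}
    (h : IsResolvent A Ψ) (v : Fin 3 → ℂ) (x : ℝ) :
    HasDerivAt (fun y => (Ψ y).mulVec v) ((A x).mulVec ((Ψ x).mulVec v)) x := by
  rw [hasDerivAt_pi]
  intro i
  rw [Matrix.mulVec_mulVec]
  simp only [Matrix.mulVec, dotProduct]
  exact HasDerivAt.fun_sum fun j _ => (h.2 x i j).mul_const (v j)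

theorem exists_mulVec_bound {A : ℝ → Matrix (Fin 3) (Fin 3) ℂ} (hA : Continuous A) (R : ℝ) :
    ∃ K, 0 < K ∧ ∀ x, |x| ≤ R → ∀ v, ‖(A x).mulVec v‖ ≤ K * ‖v‖ := by
  obtain ⟨K, hK⟩ := (isCompact_Icc (a := -R) (b := R)).exists_bound_of_continuousOn
    (continuous_mulVecCLM.comp hA).continuousOn
  refine ⟨max K 1, by positivity, fun x hx v => ?_⟩
  rw [← mulVecCLM_apply]
  refine ((mulVecCLM (A x)).le_opNorm v).trans ?_
  gcongr
  exact (hK x (abs_le.1 hx)).trans (le_max_left _ _)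

/-- Solutions of a linear system with parameter are close to approximate solutions, uniformly for
small parameters. -/
theorem exists_approximation_bound {A₀ A₁ : ℝ → Matrix (Fin 3) (Fin 3) ℂ} (hA₀ : Continuous A₀)
    (hA₁ : Continuous A₁) (R : ℝ) :
    ∃ C, 0 ≤ C ∧ ∀ (lam : ℂ) (Y Z r : ℝ → Fin 3 → ℂ) (ε : ℝ), ‖lam‖ ≤ 1 → 0 ≤ ε → Y 0 = Z 0 →
      (∀ x, HasDerivAt Y ((A₀ x + lam • A₁ x).mulVec (Y x)) x) →
      (∀ x, HasDerivAt Z ((A₀ x + lam • A₁ x).mulVec (Z x) + r x) x) →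
      (∀ x, |x| ≤ R → ‖r x‖ ≤ ε) → ∀ x, |x| ≤ R → ‖Y x - Z x‖ ≤ C * ε := by
  obtain ⟨K₀, hK₀, hb₀⟩ := exists_mulVec_bound hA₀ R
  obtain ⟨K₁, hK₁, hb₁⟩ := exists_mulVec_bound hA₁ R
  have hK : 0 < K₀ + K₁ := by positivity
  -- The constant is Gronwall's, with `K₀ + K₁` bounding the coefficients since `‖lam‖ ≤ 1`. The
  -- maximum with `0` covers negative `R`.
  refine ⟨max ((Real.exp ((K₀ + K₁) * R) - 1) / (K₀ + K₁)) 0, le_max_right _ _, ?_⟩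
  intro lam Y Z r ε hlam hε h0 hY hZ hr x hx
  have := norm_le_of_norm_deriv_le (X := fun x => Y x - Z x) hK hε (by simp [h0])
    (fun x => (hY x).sub (hZ x)) (fun x hx => ?_) x hx
  · exact this.trans (by gcongr; exact le_max_left _ _)
  · have e : (A₀ x + lam • A₁ x).mulVec (Y x) - ((A₀ x + lam • A₁ x).mulVec (Z x) + r x) =
        (A₀ x).mulVec (Y x - Z x) + lam • (A₁ x).mulVec (Y x - Z x) - r x := by
      rw [← sub_sub, ← Matrix.mulVec_sub, Matrix.add_mulVec, Matrix.smul_mulVec]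
    rw [e]
    calc _ ≤ ‖(A₀ x).mulVec (Y x - Z x)‖ + ‖lam • (A₁ x).mulVec (Y x - Z x)‖ + ‖r x‖ :=
          (norm_sub_le _ _).trans (by gcongr; exact norm_add_le _ _)
      _ ≤ K₀ * ‖Y x - Z x‖ + 1 * (K₁ * ‖Y x - Z x‖) + ε := by
          rw [norm_smul]
          gcongr
          · exact hb₀ x hx _
          · exact hb₁ x hx _
          · exact hr x hx
      _ = _ := by ring

/-- A linear combination `y₀ - c y₁` of the components of `y` such that `(y₀ - c y₁)' = -λ y₁` is
known at `L` up to the precision of `y`, improved by a factor `λ`. -/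
theorem norm_conserved_sub_le {c lam : ℂ} {Y Z : ℝ → Fin 3 → ℂ} {L η : ℝ}
    (hY : Continuous Y) (hZ : Continuous Z)
    (hd : ∀ x, HasDerivAt (fun x => Y x 0 - c * Y x 1) (-lam * Y x 1) x)
    (hYZ : ∀ x, |x| ≤ |L| → ‖Y x - Z x‖ ≤ η) :
    ‖Y L 0 - c * Y L 1 - (Y 0 0 - c * Y 0 1) + lam * ∫ x in (0 : ℝ)..L, Z x 1‖
      ≤ ‖lam‖ * (|L| * η) := by
  have hY1 : Continuous fun x => Y x 1 := (continuous_apply 1).comp hY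
  have hZ1 : Continuous fun x => Z x 1 := (continuous_apply 1).comp hZ
  rw [← intervalIntegral.integral_eq_sub_of_hasDerivAt (fun x _ => hd x)
    ((continuous_const.mul hY1).intervalIntegrable _ _), intervalIntegral.integral_const_mul,
    neg_mul, neg_add_eq_sub, ← mul_sub, ← intervalIntegral.integral_sub
    (hZ1.intervalIntegrable _ _) (hY1.intervalIntegrable _ _), norm_mul]
  gcongr
  have := intervalIntegral.norm_integral_le_of_norm_le_const (a := 0) (b := L)
    (f := fun x => Z x 1 - Y x 1) (C := η) fun x hx => by
      have hx' : |x| ≤ |L| := by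
        simpa using Set.abs_sub_left_of_mem_uIcc (Set.uIoc_subset_uIcc hx)
      rw [norm_sub_rev]
      exact (norm_le_pi_norm (Y x - Z x) 1).trans (hYZ x hx')
  rw [sub_zero] at this
  linarith [mul_comm η |L|]

end LinearSystems

/-! ### Expansion of determinants with entries of mixed orders. -/

section Asymptotics

open Asymptotics

theorem isBigO_mulVec {α : Type*} {l : Filter α} {r : α → Fin 3 → ℂ} {g : α → ℝ}
    (M : Matrix (Fin 3) (Fin 3) ℂ) (h : r =O[l] g) (i : Fin 3) :
    (fun p => M.mulVec (r p) i) =O[l] g := by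
  simp only [Matrix.mulVec, dotProduct]
  exact IsBigO.fun_sum fun j _ => ((isBigO_pi.1 h j).const_mul_left (M i j))

/-- Expansion of a determinant with entries of sizes
`n, 1, n; n², n, n; n², n, 1`. -/
theorem isBigO_det_expansion {α : Type*} {l : Filter α} {n : α → ℝ}
    (hn : n =O[l] (fun _ => (1 : ℝ))) {X : α → Matrix (Fin 3) (Fin 3) ℂ} {a d f : α → ℂ} {b g : ℂ}
    (ha : a =O[l] n) (hd : d =O[l] n) (hf : f =O[l] fun p => n p ^ 2)
    (h00 : (fun p => X p 0 0 - a p) =O[l] fun p => n p ^ 2)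
    (h01 : (fun p => X p 0 1 - b) =O[l] n) (h02 : (fun p => X p 0 2) =O[l] n)
    (h10 : (fun p => X p 1 0 - f p) =O[l] fun p => n p ^ 3)
    (h11 : (fun p => X p 1 1 - d p) =O[l] fun p => n p ^ 2)
    (h12 : (fun p => X p 1 2) =O[l] n)
    (h20 : (fun p => X p 2 0) =O[l] fun p => n p ^ 2) (h21 : (fun p => X p 2 1) =O[l] n)
    (h22 : (fun p => X p 2 2 - g) =O[l] n) :
    (fun p => (X p).det - g * (a p * d p - b * f p)) =O[l] fun p => n p ^ 3 := by
  have up : ∀ k : ℕ, (fun p => n p ^ (k + 1)) =O[l] fun p => n p ^ k := fun k => by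
    simpa [pow_succ] using (isBigO_refl (fun p => n p ^ k) l).mul hn
  have up1 : (fun p => n p ^ 2) =O[l] n := by simpa using up 1
  have one : ∀ z : ℂ, (fun _ : α => z) =O[l] fun _ => (1 : ℝ) := fun z => isBigO_const_const _
    one_ne_zero _
  have x00 : (fun p => X p 0 0) =O[l] n := by simpa using (h00.trans up1).add ha
  have x11 : (fun p => X p 1 1) =O[l] n := by simpa using (h11.trans up1).add hd
  have x10 : (fun p => X p 1 0) =O[l] fun p => n p ^ 2 := by simpa using (h10.trans (up 2)).add hf
  have x01 : (fun p => X p 0 1) =O[l] fun _ => (1 : ℝ) := by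
    simpa using (h01.trans hn).add (one b)
  have x22 : (fun p => X p 2 2) =O[l] fun _ => (1 : ℝ) := by
    simpa using (h22.trans hn).add (one g)
  have t1 : (fun p => (X p 0 0 - a p) * X p 1 1 * X p 2 2) =O[l] fun p => n p ^ 3 :=
    ((h00.mul x11).mul x22).congr_right fun p => by ring
  have t2 : (fun p => a p * (X p 1 1 - d p) * X p 2 2) =O[l] fun p => n p ^ 3 :=
    ((ha.mul h11).mul x22).congr_right fun p => by ring
  have t3 : (fun p => a p * d p * (X p 2 2 - g)) =O[l] fun p => n p ^ 3 :=
    ((ha.mul hd).mul h22).congr_right fun p => by ring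
  have t4 : (fun p => X p 0 0 * X p 1 2 * X p 2 1) =O[l] fun p => n p ^ 3 :=
    ((x00.mul h12).mul h21).congr_right fun p => by ring
  have t5 : (fun p => (X p 0 1 - b) * X p 1 0 * X p 2 2) =O[l] fun p => n p ^ 3 :=
    ((h01.mul x10).mul x22).congr_right fun p => by ring
  have t6 : (fun p => b * (X p 1 0 - f p) * X p 2 2) =O[l] fun p => n p ^ 3 :=
    (((one b).mul h10).mul x22).congr_right fun p => by ring
  have t7 : (fun p => b * f p * (X p 2 2 - g)) =O[l] fun p => n p ^ 3 :=
    (((one b).mul hf).mul h22).congr_right fun p => by ring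
  have t8 : (fun p => X p 0 1 * X p 1 2 * X p 2 0) =O[l] fun p => n p ^ 3 :=
    ((x01.mul h12).mul h20).congr_right fun p => by ring
  have t9 : (fun p => X p 0 2 * X p 1 0 * X p 2 1) =O[l] fun p => n p ^ 3 :=
    (((h02.mul x10).mul h21).congr_right fun p => by ring).trans (up 3)
  have t10 : (fun p => X p 0 2 * X p 1 1 * X p 2 0) =O[l] fun p => n p ^ 3 :=
    (((h02.mul x11).mul h20).congr_right fun p => by ring).trans (up 3)
  -- `t1`–`t3` telescope the diagonal product and `t5`–`t7` the product `X₀₁ X₁₀ X₂₂`; the four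
  -- other permutations are already of third order.
  refine (((((((((t1.add t2).add t3).sub t4).sub t5).sub t6).sub t7).add t8).add t9).sub
    t10).congr_left fun p => ?_
  rw [Matrix.det_fin_three]
  ring

/-- Division by a function `1 - κ λ` in an expansion with quadratic leading term. -/
theorem isBigO_sub_of_mul {α : Type*} {l : Filter α} {n : α → ℝ} (hn : Filter.Tendsto n l (𝓝 0))
    {E K w : α → ℂ} (hw : w =O[l] n) (hK : K =O[l] fun p => n p ^ 2)
    (h : (fun p => (1 - w p) * E p - K p) =O[l] fun p => n p ^ 3) :
    (fun p => E p - K p) =O[l] fun p => n p ^ 3 := by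
  have hn1 : n =O[l] (fun _ => (1 : ℝ)) := hn.isBigO_one ℝ
  have up : (fun p => n p ^ 3) =O[l] fun p => n p ^ 2 :=
    ((isBigO_refl (fun p => n p ^ 2) l).mul hn1).congr (fun p => by ring) fun p => by ring
  have hw0 : Filter.Tendsto w l (𝓝 0) := hw.trans_tendsto hn
  have hwE : (fun p => (1 - w p) * E p) =O[l] fun p => n p ^ 2 := by
    simpa using (h.trans up).add hK
  -- An a priori bound: `‖1 - w‖ ≥ 1/2` near the limit, so `E` is of second order and `w E` is
  -- absorbed in the error.
  have hE : E =O[l] fun p => n p ^ 2 := by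
    refine (IsBigO.of_bound 2 ?_ : E =O[l] fun p => (1 - w p) * E p).trans hwE
    have : ∀ᶠ p in l, ‖w p‖ < 1 / 2 := by
      have := hw0.norm
      rw [norm_zero] at this
      exact this.eventually_lt_const (by norm_num)
    filter_upwards [this] with p hp
    have h1 : 1 / 2 ≤ ‖1 - w p‖ := by
      have := norm_sub_norm_le (1 : ℂ) (w p)
      rw [norm_one] at this
      linarith
    rw [norm_mul]
    nlinarith [norm_nonneg (E p)]
  have hwE3 : (fun p => w p * E p) =O[l] fun p => n p ^ 3 :=
    (hw.mul hE).congr_right fun p => by ring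
  exact (h.add hwE3).congr_left fun p => by ring

end Asymptotics

/-! ### Expansion of the Evans function of an abstract system. -/

section EvansExpansion

open Asymptotics

/-- The size of a pair of small parameters. -/
noncomputable def pairSize (p : ℂ × ℂ) : ℝ := ‖p.1‖ + ‖p.2‖

theorem tendsto_pairSize : Filter.Tendsto pairSize (𝓝 (0, 0)) (𝓝 0) := by
  have : Continuous pairSize := by unfold pairSize; fun_prop
  simpa [pairSize] using this.tendsto (0, 0)

theorem pairSize_nonneg (p : ℂ × ℂ) : 0 ≤ pairSize p := by unfold pairSize; positivity

theorem isBigO_fst : (fun p : ℂ × ℂ => p.1) =O[𝓝 (0, 0)] pairSize :=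
  IsBigO.of_bound 1 (Filter.Eventually.of_forall fun p => by
    rw [Real.norm_of_nonneg (pairSize_nonneg p), pairSize]
    linarith [norm_nonneg p.2])

theorem isBigO_snd : (fun p : ℂ × ℂ => p.2) =O[𝓝 (0, 0)] pairSize :=
  IsBigO.of_bound 1 (Filter.Eventually.of_forall fun p => by
    rw [Real.norm_of_nonneg (pairSize_nonneg p), pairSize]
    linarith [norm_nonneg p.1])

theorem isBigO_exp_sub_one :
    (fun p : ℂ × ℂ => Complex.exp p.2 - 1) =O[𝓝 (0, 0)] pairSize := by
  have h : (fun z : ℂ => Complex.exp z - 1) =O[𝓝 0] fun z => z := by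
    simpa using (Complex.hasDerivAt_exp 0).isBigO_sub
  exact (h.comp_tendsto (continuous_snd.tendsto ((0, 0) : ℂ × ℂ))).trans isBigO_snd

theorem isBigO_exp_sub_one_sub :
    (fun p : ℂ × ℂ => Complex.exp p.2 - 1 - p.2) =O[𝓝 (0, 0)] fun p => pairSize p ^ 2 := by
  have h : (fun z : ℂ => Complex.exp z - 1 - z) =O[𝓝 0] fun z => z ^ 2 := by
    refine IsBigO.of_bound 1 ?_
    filter_upwards [Metric.ball_mem_nhds (0 : ℂ) one_pos] with z hz
    rw [mem_ball_zero_iff] at hz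
    simpa using Complex.norm_exp_sub_one_sub_id_le hz.le
  exact (h.comp_tendsto (continuous_snd.tendsto ((0, 0) : ℂ × ℂ))).trans (isBigO_snd.pow 2)

theorem isBigO_smul_const {f : ℂ × ℂ → ℂ} {g : ℂ × ℂ → ℝ} (h : f =O[𝓝 (0, 0)] g)
    (v : Fin 3 → ℂ) : (fun p => f p • v) =O[𝓝 (0, 0)] g :=
  isBigO_pi.2 fun i => by
    simpa [mul_comm] using h.const_mul_left (v i)

/-- Expansion at the origin of the Evans function of a system `Y' = (A₀ + λ A₁) Y` with a conserved
quantity, with a Jordan block at `λ = 0` spanned by the wave's derivatives. -/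
theorem evans_expansion {A₀ A₁ : ℝ → Matrix (Fin 3) (Fin 3) ℂ} (hA₀ : Continuous A₀)
    (hA₁ : Continuous A₁) {Ψ : ℂ → ℝ → Matrix (Fin 3) (Fin 3) ℂ}
    (hΨ : ∀ lam, IsResolvent (fun x => A₀ x + lam • A₁ x) (Ψ lam)) {c : ℂ}
    (hcons : ∀ (lam : ℂ) x v, (A₀ x + lam • A₁ x).mulVec v 0 - c * (A₀ x + lam • A₁ x).mulVec v 1 =
      -lam * v 1)
    {V₀ Vc Vq V₃ : ℝ → Fin 3 → ℂ} (hV₀ : ∀ x, HasDerivAt V₀ ((A₀ x).mulVec (V₀ x)) x)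
    (hVc : ∀ x, HasDerivAt Vc ((A₀ x).mulVec (Vc x) - (A₁ x).mulVec (V₀ x)) x)
    (hVq : ∀ x, HasDerivAt Vq ((A₀ x).mulVec (Vq x)) x)
    (hV₃ : ∀ x, HasDerivAt V₃ ((A₀ x).mulVec (V₃ x)) x) {L : ℝ} {Lc Lq ρ h₀ Ic Iq : ℂ}
    (p₀ : V₀ L = V₀ 0) (pc : Vc L = Vc 0 - Lc • V₀ 0) (pq : Vq L = Vq 0 - Lq • V₀ 0)
    (p₃ : V₃ L = ρ • V₃ 0) (c₀ : V₀ 0 0 - c * V₀ 0 1 = 0) (cc : Vc 0 0 - c * Vc 0 1 = h₀)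
    (cq : Vq 0 0 - c * Vq 0 1 = -1) (c₃ : V₃ 0 0 - c * V₃ 0 1 = 0)
    (i₀ : ∫ x in (0 : ℝ)..L, V₀ x 1 = 0) (ic : ∫ x in (0 : ℝ)..L, Vc x 1 = Ic)
    (iq : ∫ x in (0 : ℝ)..L, Vq x 1 = Iq)
    (hB : (Matrix.of fun i j => (![V₀ 0, Vq 0, V₃ 0] : Fin 3 → Fin 3 → ℂ) j i).det ≠ 0) :
    (fun p : ℂ × ℂ => (Ψ p.1 L - Complex.exp p.2 • (1 : Matrix (Fin 3) (Fin 3) ℂ)).det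
      - (ρ - 1) * ((p.1 * Lc - p.2) * (p.1 * Iq - p.2) - Lq * (p.1 * p.2 * h₀ + p.1 ^ 2 * Ic)))
      =O[𝓝 (0, 0)] fun p => pairSize p ^ 3 := by
  set B : Matrix (Fin 3) (Fin 3) ℂ :=
    Matrix.of fun i j => (![V₀ 0, Vq 0, V₃ 0] : Fin 3 → Fin 3 → ℂ) j i with hBdef
  have hcont : ∀ {Z Z' : ℝ → Fin 3 → ℂ}, (∀ x, HasDerivAt Z (Z' x) x) → Continuous Z :=
    fun h => continuous_iff_continuousAt.2 fun x => (h x).continuousAt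
  have cV₀ := hcont hV₀
  have cVc := hcont hVc
  have cVq := hcont hVq
  have cV₃ := hcont hV₃
  obtain ⟨C, hC, happ⟩ := exists_approximation_bound hA₀ hA₁ |L|
  obtain ⟨K, hK, hA₁K⟩ := exists_mulVec_bound hA₁ |L|
  have hbd : ∀ {Z : ℝ → Fin 3 → ℂ}, Continuous Z → ∃ N, 0 ≤ N ∧ ∀ x, |x| ≤ |L| → ‖Z x‖ ≤ N := by
    intro Z hZ
    obtain ⟨N, hN⟩ := (isCompact_Icc (a := -|L|) (b := |L|)).exists_bound_of_continuousOn
      hZ.continuousOn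
    exact ⟨max N 0, le_max_right _ _, fun x hx => (hN x (abs_le.1 hx)).trans (le_max_left _ _)⟩
  have small : ∀ᶠ p : ℂ × ℂ in 𝓝 (0, 0), ‖p.1‖ ≤ 1 := by
    have : Filter.Tendsto (fun p : ℂ × ℂ => ‖p.1‖) (𝓝 (0, 0)) (𝓝 0) := by
      simpa using (continuous_fst.norm : Continuous fun p : ℂ × ℂ => ‖p.1‖).tendsto (0, 0)
    exact (this.eventually_lt_const one_pos).mono fun _ h => h.le
  -- Approximate solutions with a residual of size `|λ| ^ m`.
  have general : ∀ (m : ℕ) (Z : ℂ → ℝ → Fin 3 → ℂ) (W : ℝ → Fin 3 → ℂ), Continuous W →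
      (∀ lam x, HasDerivAt (Z lam) ((A₀ x + lam • A₁ x).mulVec (Z lam x)
        + (lam ^ m) • (A₁ x).mulVec (W x)) x) →
      ((fun p : ℂ × ℂ => (Ψ p.1 L).mulVec (Z p.1 0) - Z p.1 L)
        =O[𝓝 (0, 0)] fun p => pairSize p ^ m) ∧
      ((fun p : ℂ × ℂ => (Ψ p.1 L).mulVec (Z p.1 0) 0 - c * (Ψ p.1 L).mulVec (Z p.1 0) 1
        - (Z p.1 0 0 - c * Z p.1 0 1) + p.1 * ∫ x in (0 : ℝ)..L, Z p.1 x 1)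
        =O[𝓝 (0, 0)] fun p => pairSize p ^ (m + 1)) := by
    intro m Z W hW hZ
    obtain ⟨N, hN, hWN⟩ := hbd hW
    have close : ∀ lam : ℂ, ‖lam‖ ≤ 1 → ∀ x, |x| ≤ |L| →
        ‖(Ψ lam x).mulVec (Z lam 0) - Z lam x‖ ≤ C * (‖lam‖ ^ m * (K * N)) := by
      intro lam hlam
      refine happ lam _ (Z lam) (fun x => (lam ^ m) • (A₁ x).mulVec (W x)) _ hlam (by positivity)
        (by rw [(hΨ lam).1, Matrix.one_mulVec]) ((hΨ lam).hasDerivAt_mulVec _) (hZ lam) ?_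
      intro x hx
      rw [norm_smul, norm_pow]
      gcongr
      exact (hA₁K x hx _).trans (by gcongr; exact hWN x hx)
    -- Integrating `(q - c h)' = -λ h` with the approximate `h` gains a factor `λ` over `close`.
    have cons : ∀ lam : ℂ, ‖lam‖ ≤ 1 →
        ‖(Ψ lam L).mulVec (Z lam 0) 0 - c * (Ψ lam L).mulVec (Z lam 0) 1
        - (Z lam 0 0 - c * Z lam 0 1) + lam * ∫ x in (0 : ℝ)..L, Z lam x 1‖ ≤
        ‖lam‖ * (|L| * (C * (‖lam‖ ^ m * (K * N)))) := by
      intro lam hlam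
      have hY := (hΨ lam).hasDerivAt_mulVec (Z lam 0)
      have := norm_conserved_sub_le (c := c) (lam := lam) (Z := Z lam) (L := L)
        (hcont hY) (hcont (hZ lam)) (fun x => ?_) (close lam hlam)
      · rw [(hΨ lam).1, Matrix.one_mulVec] at this
        exact this
      · have h := (hasDerivAt_pi.1 (hY x) 0).sub ((hasDerivAt_pi.1 (hY x) 1).const_mul c)
        exact h.congr_deriv (hcons lam x _)
    have le : ∀ p : ℂ × ℂ, ‖p.1‖ ≤ pairSize p := fun p => by
      rw [pairSize]; linarith [norm_nonneg p.2]
    constructor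
    · refine IsBigO.of_bound (C * (K * N)) ?_
      filter_upwards [small] with p hp
      rw [Real.norm_of_nonneg (pow_nonneg (pairSize_nonneg p) m)]
      calc _ ≤ C * (‖p.1‖ ^ m * (K * N)) := close p.1 hp L le_rfl
        _ ≤ C * (pairSize p ^ m * (K * N)) := by gcongr; exact le p
        _ = _ := by ring
    · refine IsBigO.of_bound (|L| * C * (K * N)) ?_
      filter_upwards [small] with p hp
      rw [Real.norm_of_nonneg (pow_nonneg (pairSize_nonneg p) _)]
      calc _ ≤ ‖p.1‖ * (|L| * (C * (‖p.1‖ ^ m * (K * N)))) := cons p.1 hp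
        _ = |L| * C * (K * N) * ‖p.1‖ ^ (m + 1) := by ring
        _ ≤ _ := by gcongr; exact le p
  -- The forcing `-A₁ V₀` of `Vc` cancels the error `λ A₁ V₀`, leaving the residual `λ² A₁ Vc`.
  obtain ⟨y₁, l₁⟩ := general 2 (fun lam x => V₀ x - lam • Vc x) Vc cVc fun lam x => by
    refine ((hV₀ x).sub ((hVc x).const_smul lam)).congr_deriv ?_
    simp only [Matrix.add_mulVec, Matrix.mulVec_sub, Matrix.mulVec_smul, Matrix.smul_mulVec]
    module
  -- First order suffices for `Vq` and `V₃`, which are left uncorrected: the error is `-λ A₁`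
  -- applied to them.
  obtain ⟨y₂, l₂⟩ := general 1 (fun _ x => Vq x) (fun x => -Vq x) cVq.neg fun lam x => by
    refine (hVq x).congr_deriv ?_
    simp only [Matrix.add_mulVec, Matrix.mulVec_neg, Matrix.smul_mulVec]
    module
  obtain ⟨y₃, l₃⟩ := general 1 (fun _ x => V₃ x) (fun x => -V₃ x) cV₃.neg fun lam x => by
    refine (hV₃ x).congr_deriv ?_
    simp only [Matrix.add_mulVec, Matrix.mulVec_neg, Matrix.smul_mulVec]
    module
  simp only [pow_one] at y₂ y₃
  set M : ℂ × ℂ → Matrix (Fin 3) (Fin 3) ℂ := fun p => Ψ p.1 L - Complex.exp p.2 • 1 with hM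
  have hMv : ∀ p v, (M p).mulVec v = (Ψ p.1 L).mulVec v - Complex.exp p.2 • v := fun p v => by
    rw [hM, Matrix.sub_mulVec, Matrix.smul_mulVec, Matrix.one_mulVec]
  have nn : pairSize =O[𝓝 (0, 0)] fun _ => (1 : ℝ) := tendsto_pairSize.isBigO_one ℝ
  have sq {f g : ℂ × ℂ → ℂ} (hf : f =O[𝓝 (0, 0)] pairSize) (hg : g =O[𝓝 (0, 0)] pairSize) :
      (fun p => f p * g p) =O[𝓝 (0, 0)] fun p => pairSize p ^ 2 :=
    (hf.mul hg).congr_right fun p => by ring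
  have cube {f g : ℂ × ℂ → ℂ} (hf : f =O[𝓝 (0, 0)] pairSize)
      (hg : g =O[𝓝 (0, 0)] fun p => pairSize p ^ 2) :
      (fun p => f p * g p) =O[𝓝 (0, 0)] fun p => pairSize p ^ 3 :=
    (hf.mul hg).congr_right fun p => by ring
  -- The images of the three initial data.
  have e₁ : (fun p => (M p).mulVec (V₀ 0 - p.1 • Vc 0) - (p.1 * Lc - p.2) • V₀ 0)
      =O[𝓝 (0, 0)] fun p => pairSize p ^ 2 := by
    refine ((y₁.sub (isBigO_smul_const isBigO_exp_sub_one_sub (V₀ 0))).add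
      (isBigO_smul_const (sq isBigO_fst isBigO_exp_sub_one) (Vc 0))).congr_left fun p => ?_
    rw [hMv, p₀, pc]
    module
  have e₂ : (fun p => (M p).mulVec (Vq 0) - (-Lq) • V₀ 0) =O[𝓝 (0, 0)] pairSize := by
    refine (y₂.sub (isBigO_smul_const isBigO_exp_sub_one (Vq 0))).congr_left fun p => ?_
    rw [hMv, pq]
    module
  have e₃ : (fun p => (M p).mulVec (V₃ 0) - (ρ - 1) • V₃ 0) =O[𝓝 (0, 0)] pairSize := by
    refine (y₃.sub (isBigO_smul_const isBigO_exp_sub_one (V₃ 0))).congr_left fun p => ?_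
    rw [hMv, p₃]
    module
  have k₁ : (fun p : ℂ × ℂ => -((M p).mulVec (V₀ 0 - p.1 • Vc 0) 0
      - c * (M p).mulVec (V₀ 0 - p.1 • Vc 0) 1) - -(p.1 * p.2 * h₀ + p.1 ^ 2 * Ic))
      =O[𝓝 (0, 0)] fun p => pairSize p ^ 3 := by
    refine (l₁.neg_left.sub ((cube isBigO_fst isBigO_exp_sub_one_sub).const_mul_left
      h₀)).congr_left fun p => ?_
    have hI : ∫ x in (0 : ℝ)..L, (V₀ x - p.1 • Vc x) 1 = -(p.1 * Ic) := by
      simp only [Pi.sub_apply, Pi.smul_apply, smul_eq_mul]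
      rw [intervalIntegral.integral_sub, i₀, intervalIntegral.integral_const_mul, ic, zero_sub]
      · exact ((continuous_apply 1).comp cV₀).intervalIntegrable _ _
      · exact (continuous_const.mul ((continuous_apply 1).comp cVc)).intervalIntegrable _ _
    rw [hI, hMv]
    simp only [Pi.sub_apply, Pi.smul_apply, smul_eq_mul]
    linear_combination (1 - Complex.exp p.2) * c₀ - p.1 * (1 - Complex.exp p.2) * cc
  have k₂ : (fun p : ℂ × ℂ => -((M p).mulVec (Vq 0) 0 - c * (M p).mulVec (Vq 0) 1)
      - (p.1 * Iq - p.2)) =O[𝓝 (0, 0)] fun p => pairSize p ^ 2 := by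
    refine (l₂.neg_left.sub isBigO_exp_sub_one_sub).congr_left fun p => ?_
    rw [iq, hMv]
    simp only [Pi.sub_apply, Pi.smul_apply, smul_eq_mul]
    linear_combination (1 - Complex.exp p.2) * cq
  have k₃ : (fun p : ℂ × ℂ => -((M p).mulVec (V₃ 0) 0 - c * (M p).mulVec (V₃ 0) 1))
      =O[𝓝 (0, 0)] pairSize := by
    have up : (fun p : ℂ × ℂ => pairSize p ^ (1 + 1)) =O[𝓝 (0, 0)] pairSize :=
      ((isBigO_refl pairSize _).mul nn).congr (fun p => by ring) fun p => by ring
    refine ((l₃.trans up).neg_left.add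
      (isBigO_fst.const_mul_left (∫ x in (0 : ℝ)..L, V₃ x 1))).congr_left fun p => ?_
    rw [hMv]
    simp only [Pi.sub_apply, Pi.smul_apply, smul_eq_mul]
    linear_combination (1 - Complex.exp p.2) * c₃
  -- The matrix of the monodromy minus `exp ν` in the basis of initial data.
  have hBu : IsUnit B.det := isUnit_iff_ne_zero.2 hB
  have hcol : ∀ j, B⁻¹.mulVec ((![V₀ 0, Vq 0, V₃ 0] : Fin 3 → Fin 3 → ℂ) j) = Pi.single j 1 := by
    intro j
    have : (![V₀ 0, Vq 0, V₃ 0] : Fin 3 → Fin 3 → ℂ) j = B.mulVec (Pi.single j 1) := by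
      rw [Matrix.mulVec_single_one]; rfl
    rw [this, Matrix.mulVec_mulVec, Matrix.nonsing_inv_mul _ hBu, Matrix.one_mulVec]
  -- The form `-(w₀ - c w₁)` vanishes on `V₀` and `V₃` and equals `1` on `Vq`, so it is the
  -- coordinate along `Vq`. The sharper bounds `k₁`, `k₂`, `k₃` thus apply to the middle row.
  have hrow : ∀ w : Fin 3 → ℂ, B⁻¹.mulVec w 1 = -(w 0 - c * w 1) := by
    intro w
    have hw : w = B.mulVec (B⁻¹.mulVec w) := by
      rw [Matrix.mulVec_mulVec, Matrix.mul_nonsing_inv _ hBu, Matrix.one_mulVec]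
    generalize B⁻¹.mulVec w = u at *
    rw [hw]
    simp only [hBdef, Matrix.mulVec, dotProduct, Fin.sum_univ_three, Matrix.of_apply,
      Matrix.cons_val_zero, Matrix.cons_val_one, Matrix.cons_val]
    linear_combination u 0 * c₀ + u 1 * cq + u 2 * c₃
  set Vm : ℂ × ℂ → Matrix (Fin 3) (Fin 3) ℂ := fun p =>
    Matrix.of fun i j => (![V₀ 0 - p.1 • Vc 0, Vq 0, V₃ 0] : Fin 3 → Fin 3 → ℂ) j i with hVm
  have hX : ∀ p i j, (B⁻¹ * (M p * Vm p)) i j = B⁻¹.mulVec ((M p).mulVec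
      ((![V₀ 0 - p.1 • Vc 0, Vq 0, V₃ 0] : Fin 3 → Fin 3 → ℂ) j)) i := fun p i j => rfl
  have hX0 : ∀ p i, (B⁻¹ * (M p * Vm p)) i 0 =
      B⁻¹.mulVec ((M p).mulVec (V₀ 0 - p.1 • Vc 0)) i := fun p i => hX p i 0
  have hX1 : ∀ p i, (B⁻¹ * (M p * Vm p)) i 1 = B⁻¹.mulVec ((M p).mulVec (Vq 0)) i :=
    fun p i => hX p i 1
  have hX2 : ∀ p i, (B⁻¹ * (M p * Vm p)) i 2 = B⁻¹.mulVec ((M p).mulVec (V₃ 0)) i :=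
    fun p i => hX p i 2
  have col0 : B⁻¹.mulVec (V₀ 0) = Pi.single 0 1 := hcol 0
  have col2 : B⁻¹.mulVec (V₃ 0) = Pi.single 2 1 := hcol 2
  have f₁ := isBigO_mulVec B⁻¹ e₁
  have f₂ := isBigO_mulVec B⁻¹ e₂
  have f₃ := isBigO_mulVec B⁻¹ e₃
  simp only [Matrix.mulVec_sub B⁻¹, Matrix.mulVec_smul B⁻¹, col0, col2, Pi.sub_apply,
    Pi.smul_apply, smul_eq_mul, ← hX0, ← hX1, ← hX2] at f₁ f₂ f₃
  have lin (z w : ℂ) : (fun p : ℂ × ℂ => p.1 * z - p.2 * w) =O[𝓝 (0, 0)] pairSize :=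
    ((isBigO_fst.const_mul_left z).sub (isBigO_snd.const_mul_left w)).congr_left
      fun p => by ring
  have ha (z : ℂ) : (fun p : ℂ × ℂ => p.1 * z - p.2) =O[𝓝 (0, 0)] pairSize := by
    simpa using lin z 1
  have hf : (fun p : ℂ × ℂ => -(p.1 * p.2 * h₀ + p.1 ^ 2 * Ic)) =O[𝓝 (0, 0)]
      fun p => pairSize p ^ 2 :=
    (((sq isBigO_fst isBigO_snd).const_mul_left (-h₀)).add
      ((sq isBigO_fst isBigO_fst).const_mul_left (-Ic))).congr_left fun p => by ring
  have hdet := isBigO_det_expansion (X := fun p => B⁻¹ * (M p * Vm p)) (b := -Lq) (g := ρ - 1)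
    nn (ha Lc) (ha Iq) hf (by simpa using f₁ 0) (by simpa using f₂ 0) (by simpa using f₃ 0)
    (by simpa only [hX0, hrow] using k₁) (by simpa only [hX1, hrow] using k₂)
    (by simpa only [hX2, hrow] using k₃) (by simpa using f₁ 2) (by simpa using f₂ 2)
    (by simpa using f₃ 2)
  -- The initial data depend on `λ` through the first column only, so their determinant relative to
  -- `B` is affine in `λ`.
  set κ : ℂ := B.det⁻¹ *
    (Matrix.of fun i j => (![Vc 0, Vq 0, V₃ 0] : Fin 3 → Fin 3 → ℂ) j i).det with hκ
  have hVmdet : ∀ p, B.det⁻¹ * (Vm p).det = 1 - p.1 * κ := by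
    intro p
    have : (Vm p).det = B.det - p.1 *
        (Matrix.of fun i j => (![Vc 0, Vq 0, V₃ 0] : Fin 3 → Fin 3 → ℂ) j i).det := by
      simp only [hVm, hBdef, Matrix.det_fin_three, Matrix.of_apply, Matrix.cons_val_zero,
        Matrix.cons_val_one, Matrix.cons_val, Pi.sub_apply, Pi.smul_apply, smul_eq_mul]
      ring
    rw [this, hκ]
    field_simp
  refine isBigO_sub_of_mul (n := pairSize) tendsto_pairSize (w := fun p => p.1 * κ)
    (by simpa [mul_comm] using isBigO_fst.const_mul_left κ)
    (K := fun p : ℂ × ℂ =>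
      (ρ - 1) * ((p.1 * Lc - p.2) * (p.1 * Iq - p.2) - Lq * (p.1 * p.2 * h₀ + p.1 ^ 2 * Ic)))
    ?_ ?_
  · refine (((sq (ha Lc) (ha Iq)).add (hf.const_mul_left Lq)).const_mul_left (ρ - 1)).congr_left
      fun p => by ring
  · refine hdet.congr_left fun p => ?_
    rw [Matrix.det_mul, Matrix.det_mul, Matrix.det_nonsing_inv, Ring.inverse_eq_inv',
      ← hVmdet]
    ring

end EvansExpansion

/-! ### The second Floquet solution. -/

section FloquetSolution

theorem eq_zero_of_linear_ode {A : ℝ → Matrix (Fin 3) (Fin 3) ℂ} (hA : Continuous A)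
    {V : ℝ → Fin 3 → ℂ} (hV : ∀ x, HasDerivAt V ((A x).mulVec (V x)) x) (h0 : V 0 = 0) (x : ℝ) :
    V x = 0 := by
  obtain ⟨K, hK, hb⟩ := exists_mulVec_bound hA |x|
  have := norm_le_of_norm_deriv_le hK le_rfl h0 hV
    (fun y hy => by simpa using hb y hy (V y)) x le_rfl
  simpa using this

/-- The solution with multiplier `exp (∫ τ)` in the plane of zero conserved quantity, when this
multiplier is not `1`. -/
theorem exists_floquet_solution {A : ℝ → Matrix (Fin 3) (Fin 3) ℂ} (hA : Continuous A) {c : ℂ}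
    (r₀ : ∀ x v, (A x).mulVec v 0 = c * v 2) (r₁ : ∀ x v, (A x).mulVec v 1 = v 2) {τ : ℝ → ℝ}
    (hτ : Continuous τ) (r₂ : ∀ x, A x 2 2 = τ x) {V : ℝ → Fin 3 → ℂ}
    (hV : ∀ x, HasDerivAt V ((A x).mulVec (V x)) x) {L : ℝ} (hper : V L = V 0)
    (c₀ : V 0 0 - c * V 0 1 = 0) (hne : V 0 1 ^ 2 + V 0 2 ^ 2 ≠ 0)
    (hρ : Real.exp (∫ x in (0 : ℝ)..L, τ x) ≠ 1) :
    ∃ W : ℝ → Fin 3 → ℂ, (∀ x, HasDerivAt W ((A x).mulVec (W x)) x) ∧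
      W L = ((Real.exp (∫ x in (0 : ℝ)..L, τ x) : ℝ) : ℂ) • W 0 ∧ W 0 0 - c * W 0 1 = 0 ∧
      V 0 1 * W 0 2 - V 0 2 * W 0 1 ≠ 0 := by
  set ρ : ℂ := ((Real.exp (∫ x in (0 : ℝ)..L, τ x) : ℝ) : ℂ) with hρdef
  have hρ1 : ρ - 1 ≠ 0 := by
    rw [sub_ne_zero, hρdef]; exact_mod_cast hρ
  -- The data are `(h, h')` of `V` turned by a right angle, with first component chosen so that `q =
  -- c h`; the Wronskian with `V` at `0` is then `h² + h'²`, assumed nonzero.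
  obtain ⟨w, hw0, hw⟩ := exists_hasDerivAt_linear (continuous_mulVecCLM.comp hA)
    ![-(c * V 0 2), -V 0 2, V 0 1]
  simp only [Function.comp_apply, mulVecCLM_apply] at hw
  have w0 : w 0 0 = -(c * V 0 2) := by rw [hw0]; rfl
  have w1 : w 0 1 = -V 0 2 := by rw [hw0]; rfl
  have w2 : w 0 2 = V 0 1 := by rw [hw0]; rfl
  have cons : ∀ {Y : ℝ → Fin 3 → ℂ}, (∀ x, HasDerivAt Y ((A x).mulVec (Y x)) x) →
      Y 0 0 - c * Y 0 1 = 0 → ∀ x, Y x 0 = c * Y x 1 := by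
    intro Y hY h0 x
    have hd : ∀ x, HasDerivAt (fun x => Y x 0 - c * Y x 1) 0 x := fun x => by
      refine ((hasDerivAt_pi.1 (hY x) 0).sub
        ((hasDerivAt_pi.1 (hY x) 1).const_mul c)).congr_deriv ?_
      rw [r₀, r₁, sub_self]
    have := is_const_of_deriv_eq_zero (fun x => (hd x).differentiableAt)
      (fun x => (hd x).deriv) x 0
    rw [h0] at this
    exact sub_eq_zero.1 this
  have cV := cons hV c₀
  have cw := cons hw (by rw [w0, w1]; ring)
  -- Liouville's formula: on `q = c h` the system for `(h, h')` has trace `τ`.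
  have hWr : ∀ x, HasDerivAt (fun x => V x 1 * w x 2 - V x 2 * w x 1)
      (τ x * (V x 1 * w x 2 - V x 2 * w x 1)) x := by
    intro x
    refine (((hasDerivAt_pi.1 (hV x) 1).mul (hasDerivAt_pi.1 (hw x) 2)).sub
      ((hasDerivAt_pi.1 (hV x) 2).mul (hasDerivAt_pi.1 (hw x) 1))).congr_deriv ?_
    rw [r₁, r₁]
    simp only [Matrix.mulVec, dotProduct, Fin.sum_univ_three, r₂, cV x, cw x]
    ring
  have hT : ∀ x, HasDerivAt (fun x => ∫ s in (0 : ℝ)..x, τ s) (τ x) x := fun x =>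
    intervalIntegral.integral_hasDerivAt_right (hτ.intervalIntegrable _ _)
      hτ.aestronglyMeasurable.stronglyMeasurableAtFilter hτ.continuousAt
  have hconst : ∀ x, HasDerivAt (fun x => Complex.exp (-((∫ s in (0 : ℝ)..x, τ s : ℝ) : ℂ)) *
      (V x 1 * w x 2 - V x 2 * w x 1)) 0 x := by
    intro x
    refine (((hT x).ofReal_comp.neg.cexp).mul (hWr x)).congr_deriv ?_
    ring
  have hWL := is_const_of_deriv_eq_zero (fun x => (hconst x).differentiableAt)
    (fun x => (hconst x).deriv) L 0
  have hmul : V 0 1 * w L 2 - V 0 2 * w L 1 = ρ * (V 0 1 ^ 2 + V 0 2 ^ 2) := by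
    rw [hper, w1, w2] at hWL
    simp only [intervalIntegral.integral_same, Complex.ofReal_zero, neg_zero, Complex.exp_zero,
      one_mul] at hWL
    have e : ρ * Complex.exp (-((∫ s in (0 : ℝ)..L, τ s : ℝ) : ℂ)) = 1 := by
      rw [hρdef, Complex.ofReal_exp, ← Complex.exp_add, add_neg_cancel, Complex.exp_zero]
    linear_combination ρ * hWL - (V 0 1 * w L 2 - V 0 2 * w L 1) * e
  set D : ℂ := V 0 1 ^ 2 + V 0 2 ^ 2 with hD
  -- `α` is the component along `V 0` of `w L`; the other component, along `w 0`, is `ρ` by the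
  -- Wronskian.
  set α : ℂ := (w L 1 * V 0 1 + w L 2 * V 0 2) / D with hα
  have hαD : α * D = w L 1 * V 0 1 + w L 2 * V 0 2 := div_mul_cancel₀ _ hne
  have d1 : w L 1 = α * V 0 1 + ρ * w 0 1 := by
    apply mul_right_cancel₀ hne
    rw [w1]
    linear_combination (-V 0 1) * hαD - V 0 2 * hmul + w L 1 * hD
  have d2 : w L 2 = α * V 0 2 + ρ * w 0 2 := by
    apply mul_right_cancel₀ hne
    rw [w2]
    linear_combination (-V 0 2) * hαD + V 0 1 * hmul + w L 2 * hD
  have d0 : w L 0 = α * V 0 0 + ρ * w 0 0 := by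
    rw [cw L, cw 0, cV 0, d1]; ring
  -- From `w L = α V 0 + ρ w 0` and `V L = V 0`, the multiple of `V` that makes the sum an
  -- eigensolution is `α / (ρ - 1)`.
  refine ⟨fun x => w x + (α / (ρ - 1)) • V x, fun x => ?_, ?_, ?_, ?_⟩
  · refine ((hw x).add ((hV x).const_smul (α / (ρ - 1)))).congr_deriv ?_
    rw [Matrix.mulVec_add, Matrix.mulVec_smul]
  · beta_reduce
    rw [hper]
    ext i
    simp only [Pi.add_apply, Pi.smul_apply, smul_eq_mul]
    fin_cases i
    · simp only [Fin.zero_eta, d0]; field_simp; ring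
    · simp only [Fin.mk_one, d1]; field_simp; ring
    · simp only [Fin.reduceFinMk, d2]; field_simp; ring
  · simp only [Pi.add_apply, Pi.smul_apply, smul_eq_mul]
    rw [cw 0, cV 0]; ring
  · simp only [Pi.add_apply, Pi.smul_apply, smul_eq_mul]
    rw [w1, w2]
    convert hne using 1
    rw [hD]
    ring

end FloquetSolution

/-! ### Application to roll-waves. -/

section EvansMatrix

theorem evansMatrix_mulVec_zero (δ F c qb : ℝ) (H : ℝ → ℝ) (lam : ℂ) (x : ℝ) (v : Fin 3 → ℂ) :
    (evansMatrix δ F c qb H lam x).mulVec v 0 = -lam * v 1 + c * v 2 := by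
  simp [evansMatrix, Matrix.mulVec, dotProduct, Fin.sum_univ_three]

theorem evansMatrix_mulVec_one (δ F c qb : ℝ) (H : ℝ → ℝ) (lam : ℂ) (x : ℝ) (v : Fin 3 → ℂ) :
    (evansMatrix δ F c qb H lam x).mulVec v 1 = v 2 := by
  simp [evansMatrix, Matrix.mulVec, dotProduct, Fin.sum_univ_three]

/-- This entry is the trace of the system on `q = c h` at `λ = 0`, so its integral over a period is
the logarithm of `floquetMultiplier`. -/
theorem evansMatrix_zero_corner (δ F c qb : ℝ) (H : ℝ → ℝ) (x : ℝ) :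
    evansMatrix δ F c qb H 0 x 2 2 =
      (((1 / (δ * c)) * (fluxG_h F (H x) (c * H x - qb) + c * fluxG_q F (H x) (c * H x - qb)
        - c ^ 2) : ℝ) : ℂ) := by
  simp [evansMatrix]
  ring

end EvansMatrix

namespace IsRollWaveFamily

variable {δ F : ℝ} {U : Set (ℝ × ℝ)} {L : ℝ → ℝ → ℝ} {H : ℝ → ℝ → ℝ → ℝ}

theorem integral_dirDeriv_space (hfam : IsRollWaveFamily δ F U L H) {c q : ℝ} (hU : (c, q) ∈ U) :
    ∫ x in (0 : ℝ)..L c q, dirDeriv (uncurriedProfile H) (1, 0, 0) (x, c, q) = 0 := by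
  have hf := hfam.contDiffOn_uncurried
  rw [intervalIntegral.integral_eq_sub_of_hasDerivAt
    (fun x _ => hfam.hasDerivAt_space hf hU x)
    ((hfam.contDiff_slice (hf.dirDeriv hfam.isOpen_domain _) hU).continuous.intervalIntegrable
      _ _)]
  have := hfam.uncurried_periodic hU 0
  rw [zero_add] at this
  rw [this, sub_self]

/-- If `H'` and `H''` vanished at `0`, uniqueness for the linearized system would give `H' = 0`
everywhere, against non-constancy. The sum of squares is a valid test because the entries are real.
-/
theorem variation_space_ne_zero (hfam : IsRollWaveFamily δ F U L H) (hδ : δ ≠ 0) (hF : F ≠ 0)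
    {c q : ℝ} (hU : (c, q) ∈ U) (hc : c ≠ 0) :
    variation H c q 1 0 0 0 1 ^ 2 + variation H c q 1 0 0 0 2 ^ 2 ≠ 0 := by
  intro h
  have hr : dirDeriv (uncurriedProfile H) (1, 0, 0) (0, c, q) ^ 2 +
      dirDeriv (dirDeriv (uncurriedProfile H) (1, 0, 0)) (1, 0, 0) (0, c, q) ^ 2 = 0 := by
    have : variation H c q 1 0 0 0 1 =
      ((dirDeriv (uncurriedProfile H) (1, 0, 0) (0, c, q) : ℝ) : ℂ) := rfl
    have h2 : variation H c q 1 0 0 0 2 =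
      ((dirDeriv (dirDeriv (uncurriedProfile H) (1, 0, 0)) (1, 0, 0) (0, c, q) : ℝ) : ℂ) := rfl
    rw [this, h2] at h
    exact_mod_cast h
  have h1 : dirDeriv (uncurriedProfile H) (1, 0, 0) (0, c, q) = 0 := by
    nlinarith [sq_nonneg (dirDeriv (uncurriedProfile H) (1, 0, 0) (0, c, q)),
      sq_nonneg (dirDeriv (dirDeriv (uncurriedProfile H) (1, 0, 0)) (1, 0, 0) (0, c, q))]
  have h2 : dirDeriv (dirDeriv (uncurriedProfile H) (1, 0, 0)) (1, 0, 0) (0, c, q) = 0 := by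
    nlinarith [sq_nonneg (dirDeriv (uncurriedProfile H) (1, 0, 0) (0, c, q)),
      sq_nonneg (dirDeriv (dirDeriv (uncurriedProfile H) (1, 0, 0)) (1, 0, 0) (0, c, q))]
  have h0 : variation H c q 1 0 0 0 = 0 := by
    ext i
    fin_cases i <;> simp [variation, h1, h2]
  have hz := eq_zero_of_linear_ode (hfam.continuous_evansMatrix hU 0)
    (fun x => by simpa using hfam.hasDerivAt_variation hδ hF hU hc 1 0 0 x) h0
  have hd : ∀ x, HasDerivAt (fun x => H x c q) 0 x := fun x => by
    have e : ((dirDeriv (uncurriedProfile H) (1, 0, 0) (x, c, q) : ℝ) : ℂ) = 0 :=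
      congrFun (hz x) 1
    have := hfam.hasDerivAt_space hfam.contDiffOn_uncurried hU x
    rw [Complex.ofReal_eq_zero.1 e] at this
    exact this
  obtain ⟨x, hx⟩ := hfam.nonconst c q hU
  exact hx (is_const_of_deriv_eq_zero (fun x => (hd x).differentiableAt)
    (fun x => (hd x).deriv) x 0)

/-- Expansion of the Evans function at the origin. -/
theorem evansFunction_expansion (hfam : IsRollWaveFamily δ F U L H) (hδ : δ ≠ 0) (hF : F ≠ 0)
    {c q : ℝ} (hU : (c, q) ∈ U) (hc : c ≠ 0)
    (hρ : floquetMultiplier δ F c q (L c q) (fun x => H x c q) ≠ 1) :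
    (fun p : ℂ × ℂ =>
      evansFunction δ F c q (L c q) (fun x => H x c q) p.1 (Complex.exp p.2)
        - ((((floquetMultiplier δ F c q (L c q) (fun x => H x c q) - 1) * L c q : ℝ)) : ℂ)
          * whithamDispersion L H c q p.1 p.2)
      =O[𝓝 (0, 0)] (fun p : ℂ × ℂ => (‖p.1‖ + ‖p.2‖) ^ 3) := by
  have hf := hfam.contDiffOn_uncurried
  have hO := hfam.isOpen_domain
  have hL := hfam.L_ne_zero c q hU
  set h : ℝ → ℝ := fun x => H x c q with hh
  set τ : ℝ → ℝ := fun x => (1 / (δ * c)) * (fluxG_h F (h x) (c * h x - q)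
    + c * fluxG_q F (h x) (c * h x - q) - c ^ 2) with hτdef
  have hA := hfam.continuous_evansMatrix hU 0
  have hτ : Continuous τ := by
    have : Continuous fun x => (evansMatrix δ F c q h 0 x 2 2).re :=
      Complex.continuous_re.comp (hA.matrix_elem 2 2)
    refine this.congr fun x => ?_
    rw [evansMatrix_zero_corner, Complex.ofReal_re]
  have hρτ : floquetMultiplier δ F c q (L c q) h = Real.exp (∫ x in (0 : ℝ)..L c q, τ x) := by
    rw [floquetMultiplier, hτdef, intervalIntegral.integral_const_mul]
  have hV₀ : ∀ x, HasDerivAt (variation H c q 1 0 0)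
      ((evansMatrix δ F c q h 0 x).mulVec (variation H c q 1 0 0 x)) x := fun x => by
    simpa using hfam.hasDerivAt_variation hδ hF hU hc 1 0 0 x
  have hVq : ∀ x, HasDerivAt (variation H c q 0 0 1)
      ((evansMatrix δ F c q h 0 x).mulVec (variation H c q 0 0 1 x)) x := fun x => by
    simpa using hfam.hasDerivAt_variation hδ hF hU hc 0 0 1 x
  have hVc : ∀ x, HasDerivAt (variation H c q 0 1 0)
      ((evansMatrix δ F c q h 0 x).mulVec (variation H c q 0 1 0 x)
        - (evansSlope δ F c q h x).mulVec (variation H c q 1 0 0 x)) x := fun x => by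
    simpa using hfam.hasDerivAt_variation hδ hF hU hc 0 1 0 x
  have c₀ : variation H c q 1 0 0 0 0 - c * variation H c q 1 0 0 0 1 = 0 := by
    simp [variation]
  have cc : variation H c q 0 1 0 0 0 - c * variation H c q 0 1 0 0 1 = (H 0 c q : ℂ) := by
    simp [variation]
  have cq : variation H c q 0 0 1 0 0 - c * variation H c q 0 0 1 0 1 = -1 := by
    simp [variation]
  obtain ⟨V₃, hV₃, p₃, c₃, hWr⟩ := exists_floquet_solution hA
    (fun x v => by rw [evansMatrix_mulVec_zero, neg_zero, zero_mul, zero_add])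
    (fun x v => evansMatrix_mulVec_one _ _ _ _ _ _ _ v) hτ
    (fun x => evansMatrix_zero_corner _ _ _ _ _ x) hV₀ (hfam.variation_space_at_period hU) c₀
    (hfam.variation_space_ne_zero hδ hF hU hc) (hρτ ▸ hρ)
  have hint : ∀ s a b, ∫ x in (0 : ℝ)..L c q, variation H c q s a b x 1 =
      ((∫ x in (0 : ℝ)..L c q, dirDeriv (uncurriedProfile H) (s, a, b) (x, c, q) : ℝ) : ℂ) :=
    fun s a b => intervalIntegral.integral_ofReal
  have main := evans_expansion hA (hfam.continuous_evansSlope hU)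
    (Ψ := fun lam => resolventMatrix (evansMatrix δ F c q h lam))
    (fun lam => by
      have := isResolvent_resolventMatrix (hfam.continuous_evansMatrix hU lam)
      rwa [show (fun x => evansMatrix δ F c q h 0 x + lam • evansSlope δ F c q h x) =
        evansMatrix δ F c q h lam from funext fun x => (evansMatrix_eq _ _ _ _ _ _ x).symm])
    (c := c)
    (fun lam x v => by
      rw [← evansMatrix_eq, evansMatrix_mulVec_zero, evansMatrix_mulVec_one]; ring)
    hV₀ hVc hVq hV₃ (hfam.variation_space_at_period hU)
    (hfam.variation_parameter_at_period hU 1 0) (hfam.variation_parameter_at_period hU 0 1) p₃ c₀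
    cc cq c₃ (by rw [hint, hfam.integral_dirDeriv_space hU, Complex.ofReal_zero]) (hint 0 1 0)
    (hint 0 0 1) (by
      -- Subtracting `c` times the second row from the first leaves only `-1`, in the `Vq` column;
      -- the determinant is thus the Wronskian of `V₀` and `V₃`.
      convert hWr using 1
      rw [Matrix.det_fin_three]
      simp only [Matrix.of_apply, Matrix.cons_val_zero, Matrix.cons_val_one, Matrix.cons_val]
      generalize variation H c q 1 0 0 0 = u at *
      generalize variation H c q 0 0 1 0 = v at *
      linear_combination (v 1 * V₃ 0 2 - V₃ 0 1 * v 2) * c₀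
        - (u 1 * V₃ 0 2 - V₃ 0 1 * u 2) * cq + (u 1 * v 2 - v 1 * u 2) * c₃)
  refine main.congr_left fun p => ?_
  rw [evansFunction]
  congr 1
  -- Once the derivatives of `M` are inserted, the terms in `H(0) - M` and `M` of `L D` combine into
  -- the single term in `H(0)` of the expansion.
  have eMc : dc (massM L H) c q = _ := (hfam.hasDerivAt_massM_fst hU).deriv
  have eMq : dq (massM L H) c q = _ := (hfam.hasDerivAt_massM_snd hU).deriv
  rw [whithamDispersion, Matrix.det_fin_two_of, eMc, eMq, hρτ]
  simp only [hfam.dc_profile hU, hfam.dq_profile hU, meanL]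
  have hL' : (L c q : ℂ) ≠ 0 := Complex.ofReal_ne_zero.2 hL
  push_cast
  field_simp
  ring

/-- The dispersion relation for a family normalized by its mean value at the origin. -/
theorem whithamDispersion_of_normalized (hfam : IsRollWaveFamily δ F U L H) {c q : ℝ}
    (hU : (c, q) ∈ U) (hnorm : H 0 c q = massM L H c q) (lam ν : ℂ) :
    whithamDispersion L H c q lam ν =
      lam ^ 2 * ((dc L c q : ℂ) * (meanL (L c q) (fun x => dq (H x) c q) : ℂ)
          - (dq L c q : ℂ) * (meanL (L c q) (fun x => dc (H x) c q) : ℂ))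
        - lam * ν * ((dc L c q : ℂ) / (L c q : ℂ)
            + (meanL (L c q) (fun x => dq (H x) c q) : ℂ)
            + (massM L H c q : ℂ) * (dq L c q : ℂ) / (L c q : ℂ))
        + ν ^ 2 / (L c q : ℂ) := by
  have eMc : dc (massM L H) c q = _ := (hfam.hasDerivAt_massM_fst hU).deriv
  have eMq : dq (massM L H) c q = _ := (hfam.hasDerivAt_massM_snd hU).deriv
  rw [whithamDispersion, Matrix.det_fin_two_of, eMc, eMq, hnorm, sub_self, mul_zero, mul_zero,
    zero_add, zero_add]
  ring

end IsRollWaveFamily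

/-! ### Plane waves of the linearized Whitham system. -/

section Whitham

theorem dpar_smul (f : ℝ → ℝ → ℝ) (c q : ℝ) (e : ℂ) (v : ℂ × ℂ) :
    dpar f c q (e • v) = e * dpar f c q v := by
  simp only [dpar, Prod.smul_fst, Prod.smul_snd, smul_eq_mul]
  ring

end Whitham

namespace IsRollWaveFamily

variable {δ F : ℝ} {U : Set (ℝ × ℝ)} {L : ℝ → ℝ → ℝ} {H : ℝ → ℝ → ℝ → ℝ}

/-- Plane waves solve the linearized Whitham system iff their amplitude solves an algebraic
system. -/
theorem solvesLinearizedWhitham_planeWave_iff (hfam : IsRollWaveFamily δ F U L H) {c q : ℝ}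
    (hU : (c, q) ∈ U) (lam ν : ℂ) (v : ℂ × ℂ) :
    SolvesLinearizedWhitham L H c q
      (fun x t => Complex.exp (lam * (t : ℂ) + (waveNumber L c q : ℂ) * ν * (x : ℂ)) • v) ↔
    lam * dpar L c q v - ν * v.1 = 0 ∧
      lam * dpar (massM L H) c q v + ν / (L c q : ℂ) * ((massM L H c q : ℂ) * v.1 - v.2) = 0 := by
  have hL := hfam.L_ne_zero c q hU
  have hL' : (L c q : ℂ) ≠ 0 := Complex.ofReal_ne_zero.2 hL
  have Lc : HasDerivAt (fun z => L z q) (dc L c q) c :=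
    (hasDerivAt_fst_of_line (hfam.hasDerivAt_period hU 1 0)).differentiableAt.hasDerivAt
  have Lq : HasDerivAt (fun z => L c z) (dq L c q) q :=
    (hasDerivAt_snd_of_line (hfam.hasDerivAt_period hU 0 1)).differentiableAt.hasDerivAt
  have Mc : HasDerivAt (fun z => massM L H z q) (dc (massM L H) c q) c :=
    (hfam.hasDerivAt_massM_fst hU).differentiableAt.hasDerivAt
  have Mq : HasDerivAt (fun z => massM L H c z) (dq (massM L H) c q) q :=
    (hfam.hasDerivAt_massM_snd hU).differentiableAt.hasDerivAt
  have kc : HasDerivAt (fun z => waveNumber L z q) (-dc L c q / L c q ^ 2) c := by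
    simpa [waveNumber] using Lc.fun_inv hL
  have kq : HasDerivAt (fun z => waveNumber L c z) (-dq L c q / L c q ^ 2) q := by
    simpa [waveNumber] using Lq.fun_inv hL
  have dkc : dc (waveNumber L) c q = _ := kc.deriv
  have dkq : dq (waveNumber L) c q = _ := kq.deriv
  have dωc : dc (timeFrequency L) c q = _ := (kc.mul (hasDerivAt_id c)).neg.deriv
  have dωq : dq (timeFrequency L) c q = _ := (kq.mul_const c).neg.deriv
  have dNc : dc (massFluxN L H) c q = _ := (((hasDerivAt_id c).mul Mc).sub_const q).deriv
  have dNq : dq (massFluxN L H) c q = _ := ((Mq.const_mul c).sub (hasDerivAt_id q)).deriv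
  have ek : dpar (waveNumber L) c q v = -dpar L c q v / (L c q : ℂ) ^ 2 := by
    rw [dpar, dpar, dkc, dkq]; push_cast; ring
  -- As `ω = -k c`, the moving frame cancels the `dk` part of the flux and leaves `k dc`; likewise
  -- `N = c M - q̄` leaves `M dc - dq̄`.
  have eω : -dpar (timeFrequency L) c q v - c * dpar (waveNumber L) c q v = v.1 / L c q := by
    rw [dpar, dpar, dωc, dωq, dkc, dkq, waveNumber]
    simp only [id_eq]
    push_cast
    field_simp
    ring
  have eN : dpar (massFluxN L H) c q v - c * dpar (massM L H) c q v =
      (massM L H c q : ℂ) * v.1 - v.2 := by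
    rw [dpar, dpar, dNc, dNq]
    simp only [id_eq]
    push_cast
    ring
  set k : ℂ := (waveNumber L c q : ℂ) with hk
  have hkL : k = 1 / (L c q : ℂ) := by rw [hk, waveNumber]; push_cast; rfl
  have dt : ∀ (x t : ℝ) (z : ℂ), deriv (fun s : ℝ =>
      Complex.exp (lam * (s : ℂ) + k * ν * (x : ℂ)) * z) t =
      Complex.exp (lam * (t : ℂ) + k * ν * (x : ℂ)) * (lam * z) := by
    intro x t z
    have h1 : HasDerivAt (fun s : ℝ => lam * (s : ℂ) + k * ν * (x : ℂ)) lam t := by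
      simpa using ((Complex.ofRealCLM.hasDerivAt (x := t)).const_mul lam).add_const
        (k * ν * (x : ℂ))
    rw [(h1.cexp.mul_const z).deriv]
    ring
  have dx : ∀ (x t : ℝ) (z : ℂ), deriv (fun y : ℝ =>
      Complex.exp (lam * (t : ℂ) + k * ν * (y : ℂ)) * z) x =
      Complex.exp (lam * (t : ℂ) + k * ν * (x : ℂ)) * (k * ν * z) := by
    intro x t z
    have h1 : HasDerivAt (fun y : ℝ => lam * (t : ℂ) + k * ν * (y : ℂ)) (k * ν) x := by
      simpa using ((Complex.ofRealCLM.hasDerivAt (x := x)).const_mul (k * ν)).const_add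
        (lam * (t : ℂ))
    rw [(h1.cexp.mul_const z).deriv]
    ring
  have fω : ∀ e : ℂ, -(e * dpar (timeFrequency L) c q v) - c * (e * dpar (waveNumber L) c q v) =
      e * (v.1 / L c q) := fun e => by rw [← eω]; ring
  have fN : ∀ e : ℂ, e * dpar (massFluxN L H) c q v - c * (e * dpar (massM L H) c q v) =
      e * ((massM L H c q : ℂ) * v.1 - v.2) := fun e => by rw [← eN]; ring
  have hsmooth : ContDiff ℝ 1 (fun p : ℝ × ℝ =>
      Complex.exp (lam * (p.2 : ℂ) + k * ν * (p.1 : ℂ)) • v) := by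
    have h1 : ContDiff ℝ 1 (fun p : ℝ × ℝ => (p.1 : ℂ)) :=
      Complex.ofRealCLM.contDiff.comp contDiff_fst
    have h2 : ContDiff ℝ 1 (fun p : ℝ × ℝ => (p.2 : ℂ)) :=
      Complex.ofRealCLM.contDiff.comp contDiff_snd
    exact (((contDiff_const.mul h2).add (contDiff_const.mul h1)).cexp).smul contDiff_const
  have hs : SolvesLinearizedWhitham L H c q
      (fun x t => Complex.exp (lam * (t : ℂ) + k * ν * (x : ℂ)) • v) ↔
      ∀ x t : ℝ, Complex.exp (lam * (t : ℂ) + k * ν * (x : ℂ)) *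
          (lam * dpar (waveNumber L) c q v + k * ν * (v.1 / L c q)) = 0 ∧
        Complex.exp (lam * (t : ℂ) + k * ν * (x : ℂ)) *
          (lam * dpar (massM L H) c q v + k * ν * ((massM L H c q : ℂ) * v.1 - v.2)) = 0 := by
    simp only [SolvesLinearizedWhitham, dpar_smul, fω, fN, dt, dx, hsmooth, true_and, mul_add]
  rw [hs]
  simp only [mul_eq_zero, Complex.exp_ne_zero, false_or, forall_const]
  have e1 : lam * dpar (waveNumber L) c q v + k * ν * (v.1 / L c q) =
      -(lam * dpar L c q v - ν * v.1) / (L c q : ℂ) ^ 2 := by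
    rw [ek, hkL]; field_simp; ring
  have e2 : k * ν = ν / (L c q : ℂ) := by rw [hkL]; ring
  rw [e1, e2, div_eq_zero_iff, neg_eq_zero, or_iff_left (pow_ne_zero 2 hL')]

theorem whithamDispersion_eq_zero_iff (hfam : IsRollWaveFamily δ F U L H) {c q : ℝ}
    (hU : (c, q) ∈ U) (lam ν : ℂ) :
    whithamDispersion L H c q lam ν = 0 ↔
      ∃ v : ℂ × ℂ, v ≠ 0 ∧ SolvesLinearizedWhitham L H c q
        (fun x t => Complex.exp (lam * (t : ℂ) + (waveNumber L c q : ℂ) * ν * (x : ℂ)) • v) := by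
  simp only [hfam.solvesLinearizedWhitham_planeWave_iff hU]
  rw [whithamDispersion, ← Matrix.exists_mulVec_eq_zero_iff]
  constructor
  · rintro ⟨w, hw, h⟩
    refine ⟨(w 0, w 1), fun h0 => hw ?_, ?_, ?_⟩
    · rw [Prod.mk_eq_zero] at h0
      ext i; fin_cases i
      exacts [h0.1, h0.2]
    · have := congrFun h 0
      simp [Matrix.mulVec, dotProduct] at this
      rw [dpar]
      linear_combination this
    · have := congrFun h 1
      simp [Matrix.mulVec, dotProduct] at this
      rw [dpar]
      linear_combination this
  · rintro ⟨v, hv, h1, h2⟩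
    refine ⟨![v.1, v.2], fun h0 => hv ?_, ?_⟩
    · exact Prod.ext (congrFun h0 0) (congrFun h0 1)
    · rw [dpar] at h1 h2
      ext i
      fin_cases i
      · simp [Matrix.mulVec, dotProduct]
        linear_combination h1
      · simp [Matrix.mulVec, dotProduct]
        linear_combination h2

end IsRollWaveFamily

theorem lemma1 (δ F : ℝ) (hδ : 0 < δ) (hF : 0 < F)
    (U : Set (ℝ × ℝ)) (L : ℝ → ℝ → ℝ) (H : ℝ → ℝ → ℝ → ℝ)
    (hfam : IsRollWaveFamily δ F U L H)
    (cs qs : ℝ) (hU : (cs, qs) ∈ U) (hcs : cs ≠ 0)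
    (hρ : floquetMultiplier δ F cs qs (L cs qs) (fun x => H x cs qs) ≠ 1) :
    (∃ Γ : ℂ, Γ ≠ 0 ∧
      (fun p : ℂ × ℂ =>
        evansFunction δ F cs qs (L cs qs) (fun x => H x cs qs) p.1 (Complex.exp p.2)
          - Γ * whithamDispersion L H cs qs p.1 p.2)
        =O[𝓝 (0, 0)] (fun p : ℂ × ℂ => (‖p.1‖ + ‖p.2‖) ^ 3)) ∧
    (∀ lam ν : ℂ, whithamDispersion L H cs qs lam ν = 0 ↔
      ∃ v : ℂ × ℂ, v ≠ 0 ∧ SolvesLinearizedWhitham L H cs qs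
        (fun x t => Complex.exp (lam * (t : ℂ) + (waveNumber L cs qs : ℂ) * ν * (x : ℂ)) • v)) ∧
    ((∀ c qb, (c, qb) ∈ U → H 0 c qb = massM L H c qb) →
      ∀ lam ν : ℂ, whithamDispersion L H cs qs lam ν =
        lam ^ 2 * ((dc L cs qs : ℂ) * (meanL (L cs qs) (fun x => dq (H x) cs qs) : ℂ)
            - (dq L cs qs : ℂ) * (meanL (L cs qs) (fun x => dc (H x) cs qs) : ℂ))
          - lam * ν * ((dc L cs qs : ℂ) / (L cs qs : ℂ)
              + (meanL (L cs qs) (fun x => dq (H x) cs qs) : ℂ)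
              + (massM L H cs qs : ℂ) * (dq L cs qs : ℂ) / (L cs qs : ℂ))
          + ν ^ 2 / (L cs qs : ℂ)) := by
  refine ⟨⟨_, ?_, hfam.evansFunction_expansion hδ.ne' hF.ne' hU hcs hρ⟩,
    hfam.whithamDispersion_eq_zero_iff hU,
    fun hnorm => hfam.whithamDispersion_of_normalized hU (hnorm cs qs hU)⟩
  exact Complex.ofReal_ne_zero.2 (mul_ne_zero (sub_ne_zero.2 hρ)
    (hfam.L_ne_zero cs qs hU))
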